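/- **Setting.** Let $L$ be a (possibly infinite) language consisting of relation symbols $R$ of arities $a(R)\ge 1$ and unary function symbols $F$, equipped with a permutation group $\Gamma_L$ on $L$ that preserves types and arities. A *$\Gamma_L$-structure* $\mathbf A$ has a finite or countably infinite (possibly empty) vertex set $A$, relations $R_{\mathbf A}\subseteq A^{a(R)}$ and functions $F_{\mathbf A}\colon A\to\mathcal P(A)$. A *homomorphism* $f\colon\mathbf A\to\mathbf B$ is a pair $(f_L,f_A)$ with $f_L\in\Gamma_L$, $f_A\colon A\to B$, such that $\bar x\in R_{\mathbf A}$ implies $f_A(\bar x)\in f_L(R)_{\mathbf B}$, and $f_A(F_{\mathbf A}(x))\subseteq f_L(F)_{\mathbf B}(f_A(x))$. It is an *embedding* if $f_A$ is injective, the implication is an equivalence and the inclusion is an equality; a bijective embedding is an *isomorphism*, and an isomorphism $\mathbf A\to\mathbf A$ is an *automorphism*. Morphisms are composed in both components. A *substructure* of $\mathbf A$ is the structure induced on a subset of $A$ closed under all functions. A structure is *irreducible* if its vertex set is not the union of the vertex sets $S,T$ of two proper substructures such that no tuple in a relation meets both $S\setminus T$ and $T\setminus S$. A *homomorphism-embedding*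 is a homomorphism whose restriction to every irreducible substructure of its domain is an embedding. For a family $\mathcal F$ of structures, $\mathrm{Forb}_{he}(\mathcal F)$ is the class of all finite or countably infinite $\Gamma_L$-structures to which no $\mathbf F\in\mathcal F$ has a homomorphism-embedding. The group $\Gamma_L$ acts on the structures with a given vertex set *by relabelling*: $R_{g\mathbf A}=(g^{-1}R)_{\mathbf A}$ and $F_{g\mathbf A}=(g^{-1}F)_{\mathbf A}$. A *partial automorphism* of $\mathbf A$ is an isomorphism between two substructures of $\mathbf A$ (it includes an element of $\Gamma_L$; an automorphism extending it has the same language part). A triple $(f,g,h)$ of partial automorphisms is *coherent* if $\mathrm{Dom}(f)=\mathrm{Dom}(h)$, $\mathrm{Range}(f)=\mathrm{Dom}(g)$, $\mathrm{Range}(g)=\mathrm{Range}(h)$ and $h=g\circ f$. A finite structure $\mathbf B$ with an embedding $\psi\colon\mathbf A\to\mathbf B$ is a *coherent EPPA-witness* for $\mathbf A$ if there is a map $f\mapsto\hat f$ from the partial automorphisms of $\psi(\mathbf A)$ to $\mathrm{Aut}(\mathbf B)$ such that $\hat f$ extends $f$ and coherent triples are sent to coherent triples. It is *irreducible structure faithful*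 if for every irreducible substructure $\mathbf C$ of $\mathbf B$ there is $g\in\mathrm{Aut}(\mathbf B)$ with $g(C)\subseteq\psi(A)$. **Theorem.** Let $\mathcal F$ be a finite family of finite $\Gamma_L$-structures and let $\mathbf A\in\mathrm{Forb}_{he}(\mathcal F)$ be a finite $\Gamma_L$-structure which lies in a finite orbit of the action of $\Gamma_L$ by relabelling. If there exists a (finite or countably infinite) structure $\mathbf M\in\mathrm{Forb}_{he}(\mathcal F)$ containing $\mathbf A$ as a substructure such that each partial automorphism of $\mathbf A$ extends to an automorphism of $\mathbf M$, then there exists a finite structure $\mathbf B\in\mathrm{Forb}_{he}(\mathcal F)$ which is an irreducible structure faithful coherent EPPA-witness for $\mathbf A$ (with respect to one and the same embedding $\psi\colon\mathbf A\to\mathbf B$). -/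

import Mathlib

namespace EPPA

universe u v w w'

/-- A language consisting of relation symbols (`Rel n` is the set of relation symbols of arity
`n ≥ 1`) and unary function symbols (`Fn`), equipped with a permutation group `Γ`. Since the
permutations are given arity by arity and separately on relations and functions, these are exactly
the permutation groups on the symbols which preserve types and arities. -/
structure PermLanguage where
  Rel : ℕ+ → Type u
  Fn : Type v
  Γ : Subgroup ((∀ n : ℕ+, Equiv.Perm (Rel n)) × Equiv.Perm Fn)

namespace PermLanguage

/-- The image of a relation symbol under an element of the permutation group. -/
def onRel (L : PermLanguage.{u, v}) (g : L.Γ) {n : ℕ+} (R : L.Rel n) : L.Rel n :=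
  (g : (∀ n : ℕ+, Equiv.Perm (L.Rel n)) × Equiv.Perm L.Fn).1 n R

/-- The image of a function symbol under an element of the permutation group. -/
def onFn (L : PermLanguage.{u, v}) (g : L.Γ) (F : L.Fn) : L.Fn :=
  (g : (∀ n : ℕ+, Equiv.Perm (L.Rel n)) × Equiv.Perm L.Fn).2 F

end PermLanguage

/-- A `Γ_L`-structure with vertex set `V`: relations are sets of tuples, functions map vertices to
sets of vertices. The vertex set may be empty. -/
@[ext]
structure Str (L : PermLanguage.{u, v}) (V : Type w) where
  rel : ∀ {n : ℕ+}, L.Rel n → Set (Fin (n : ℕ) → V)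
  fn : L.Fn → V → Set V

namespace Str

variable {L : PermLanguage.{u, v}} {V : Type w} {W : Type w'}

/-- The structure `g A`: the relations and functions of `A` relabelled according to `g`. -/
def relabel (g : L.Γ) (A : Str L V) : Str L V where
  rel R := A.rel (L.onRel g⁻¹ R)
  fn F := A.fn (L.onFn g⁻¹ F)

/-- The action of `Γ_L` on the `Γ_L`-structures with vertex set `V` by relabelling. -/
instance : MulAction L.Γ (Str L V) where
  smul g A := A.relabel g
  one_smul A := by
    change A.relabel 1 = A
    ext <;> simp [relabel, PermLanguage.onRel, PermLanguage.onFn]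
  mul_smul g h A := by
    change A.relabel (g * h) = (A.relabel h).relabel g
    ext <;> simp [relabel, PermLanguage.onRel, PermLanguage.onFn]

/-- `(g, f)` is a homomorphism `A → B`. -/
structure IsHom (A : Str L V) (B : Str L W) (g : L.Γ) (f : V → W) : Prop where
  map_rel : ∀ {n : ℕ+} (R : L.Rel n) (x : Fin (n : ℕ) → V),
    x ∈ A.rel R → f ∘ x ∈ B.rel (L.onRel g R)
  map_fn : ∀ (F : L.Fn) (x : V), f '' A.fn F x ⊆ B.fn (L.onFn g F) (f x)

/-- `(g, f)` is an embedding `A → B`. -/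
structure IsEmbedding (A : Str L V) (B : Str L W) (g : L.Γ) (f : V → W) : Prop where
  injective : Function.Injective f
  map_rel : ∀ {n : ℕ+} (R : L.Rel n) (x : Fin (n : ℕ) → V),
    x ∈ A.rel R ↔ f ∘ x ∈ B.rel (L.onRel g R)
  map_fn : ∀ (F : L.Fn) (x : V), f '' A.fn F x = B.fn (L.onFn g F) (f x)

/-- `S` is the vertex set of a substructure of `A`, that is, it is closed under the functions. -/
def IsClosed (A : Str L V) (S : Set V) : Prop :=
  ∀ (F : L.Fn), ∀ x ∈ S, A.fn F x ⊆ S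

/-- The structure induced by `A` on `S`. It is the substructure of `A` with vertex set `S` when
`S` is closed, and it is only used for closed `S`. -/
def induce (A : Str L V) (S : Set V) : Str L S where
  rel R := {x | (fun i => (x i : V)) ∈ A.rel R}
  fn F x := {y | (y : V) ∈ A.fn F x}

/-- `A` is the free amalgamation of its substructures with vertex sets `S` and `T` (over their
intersection). The condition on the functions in the definition of free amalgamation concerns
tuples that contain vertices of both `S \ T` and `T \ S`, so it is void for unary functions. -/
structure IsFreeAmalgamation (A : Str L V) (S T : Set V) : Prop where
  closed_left : A.IsClosed S
  closed_right : A.IsClosed T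
  union_eq : S ∪ T = Set.univ
  free : ∀ {n : ℕ+} (R : L.Rel n), ∀ x ∈ A.rel R,
    ¬ ((∃ i, x i ∈ S \ T) ∧ (∃ j, x j ∈ T \ S))

/-- A structure is irreducible if it is not the free amalgamation of two of its proper
substructures. -/
def Irreducible (A : Str L V) : Prop :=
  ¬ ∃ S T : Set V, S ≠ Set.univ ∧ T ≠ Set.univ ∧ A.IsFreeAmalgamation S T

/-- `(g, f)` is a homomorphism-embedding `A → B`: a homomorphism whose restriction to each
irreducible substructure of `A` is an embedding. -/
structure IsHomEmbedding (A : Str L V) (B : Str L W) (g : L.Γ) (f : V → W) : Prop where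
  isHom : A.IsHom B g f
  isEmbedding_restrict : ∀ S : Set V, A.IsClosed S → (A.induce S).Irreducible →
    (A.induce S).IsEmbedding B g (fun x : S => f x)

/-- Membership in `Forb_he(F)`: the finite or countably infinite structures to which no member of
the family `F` has a homomorphism-embedding. -/
def ForbHE {ι : Type*} {U : ι → Type*} (F : ∀ i, Str L (U i)) (A : Str L V) : Prop :=
  Countable V ∧ ¬ ∃ (i : ι) (g : L.Γ) (f : U i → V), (F i).IsHomEmbedding A g f

/-- Embeddings `A → B`, with both the language part and the vertex part. -/
structure Emb (A : Str L V) (B : Str L W) where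
  perm : L.Γ
  toFun : V → W
  isEmbedding : A.IsEmbedding B perm toFun

/-- Automorphisms of `B`, with both the language part and the vertex part. -/
structure Aut (B : Str L W) where
  perm : L.Γ
  toEquiv : Equiv.Perm W
  isEmbedding : B.IsEmbedding B perm toEquiv

/-- Partial automorphisms of `A`: isomorphisms between two substructures of `A`. -/
structure PartialAut (A : Str L V) where
  perm : L.Γ
  dom : Set V
  cod : Set V
  dom_closed : A.IsClosed dom
  cod_closed : A.IsClosed cod
  toEquiv : dom ≃ cod
  isEmbedding : (A.induce dom).IsEmbedding (A.induce cod) perm toEquiv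

/-- The automorphism `e` of `B` extends `ψ ∘ f ∘ ψ⁻¹`, where `f` is a partial automorphism of `A`
and `ψ : A → B` is an embedding. The partial automorphisms of the substructure `ψ(A)` of `B` are
exactly the maps `ψ ∘ f ∘ ψ⁻¹` with `f` a partial automorphism of `A`; when the language part of
`ψ` is trivial and `ψ` is regarded as an inclusion, this says that `e` extends `f`. -/
def Aut.Extends {A : Str L V} {B : Str L W} (e : B.Aut) (ψ : A.Emb B) (f : A.PartialAut) : Prop :=
  e.perm = ψ.perm * f.perm * ψ.perm⁻¹ ∧
    ∀ x : f.dom, e.toEquiv (ψ.toFun x) = ψ.toFun (f.toEquiv x)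

/-- `(f, g, h)` is a coherent triple of partial automorphisms: the domains and ranges fit together
and `h = g ∘ f` (in the language part and in the vertex part). -/
structure PartialAut.IsCoherentTriple {A : Str L V} (f g h : A.PartialAut) : Prop where
  dom_eq : f.dom = h.dom
  mid_eq : f.cod = g.dom
  cod_eq : g.cod = h.cod
  perm_eq : h.perm = g.perm * f.perm
  map_eq : ∀ (x : f.dom) (y : g.dom) (z : h.dom),
    (z : V) = x → (y : V) = f.toEquiv x → (h.toEquiv z : V) = g.toEquiv y

/-- `(f, g, h)` is a coherent triple of automorphisms; the domains and ranges all being the whole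
vertex set, this only means `h = g ∘ f`. -/
structure Aut.IsCoherentTriple {B : Str L W} (f g h : B.Aut) : Prop where
  perm_eq : h.perm = g.perm * f.perm
  map_eq : ∀ x, h.toEquiv x = g.toEquiv (f.toEquiv x)

/-- `ψ : A → B` makes `B` a coherent EPPA-witness for `A`: the partial automorphisms of `ψ(A)`
extend to automorphisms of `B` by a coherent map. -/
def IsCoherentEPPAWitness {A : Str L V} {B : Str L W} (ψ : A.Emb B) : Prop :=
  ∃ φ : A.PartialAut → B.Aut, (∀ f, (φ f).Extends ψ f) ∧
    ∀ f g h : A.PartialAut, f.IsCoherentTriple g h → (φ f).IsCoherentTriple (φ g) (φ h)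

/-- `B` is irreducible structure faithful with respect to `ψ(A)`: each irreducible substructure of
`B` is mapped into `ψ(A)` by some automorphism of `B`. -/
def IsIrreducibleStructureFaithful {A : Str L V} {B : Str L W} (ψ : A.Emb B) : Prop :=
  ∀ C : Set W, B.IsClosed C → (B.induce C).Irreducible →
    ∃ e : B.Aut, e.toEquiv '' C ⊆ Set.range ψ.toFun

end Str

end EPPA

/-! The witness is the top of a tower of finite atlases. A `Level` is a finite set covered by
charts, injective copies of the vertices of `A` with a language part. Each partial automorphism,
read from one chart to another, extends to a permutation that maps charts to charts, functorially on
coherent triples. If charts induce the same structure on overlaps (`Compat`), the union `toStr` of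
the charts contains every chart as a copy of `A`, and these permutations make it a coherent
EPPA-witness. A level is refined by labelling vertices (`Scheme`): a vertex of `step` is a labelled
vertex together with the labelled substructure it generates, so that unary functions remain well
defined. Labels do three jobs.

Compatibility: the bottom level is the vertex set itself, with every permutation and language part
as a chart. Labels in `ZMod p` are constrained so that their sum over a vertex set tells which
structure the chart carries there (`MarkGen`). Charts with equal labels on a set therefore agree on
it (`agree_of_markGen`). Finiteness of the orbit keeps the label set finite.

Faithfulness: irreducible substructures are cliques, that is, sets whose points pairwise share a
chart (`Compat.isClique_range`). A set of `q + 1` points in no single chart can be coloured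
injectively with `q` colours on each chart, whereas a clique lying over it would need `q + 1`
colours. Refinement by `q`-colour patterns thus destroys the bad cliques of this size
(`IsClique.good_of_ncard`), and after finitely many rounds every clique lies in a chart.

Forbidden structures: every set of at most `n` vertices, `n` bounding the members of the family,
must map to `M` by a map that is an automorphism of `M` on each chart (`Real`). Refine with two
colours. If the projection of a set is an isomorphism of adjacency graphs, a parity argument makes
the graph chordal (`exists_separating_clique`), and the pieces are glued along cliques by
automorphisms of `M` (`Real.union`). Otherwise a potential drops, and a map is pulled back from
below. A homomorphism-embedding of a forbidden structure into the witness would then yield one into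
`M`. -/

namespace EPPA

namespace Str

universe u₁ u₂ u₃ u₄ u₅

variable {L : PermLanguage.{u₁, u₂}} {V : Type u₃} {W : Type u₄} {Y : Type u₅}

/-! ### Embeddings, generated substructures, partial automorphisms -/

@[simp] theorem onRel_one {n : ℕ+} (R : L.Rel n) : L.onRel 1 R = R := rfl

@[simp] theorem onFn_one (F : L.Fn) : L.onFn 1 F = F := rfl

theorem onRel_mul (g h : L.Γ) {n : ℕ+} (R : L.Rel n) :
    L.onRel (g * h) R = L.onRel g (L.onRel h R) := rfl

theorem onFn_mul (g h : L.Γ) (F : L.Fn) : L.onFn (g * h) F = L.onFn g (L.onFn h F) := rfl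

@[simp] theorem onRel_inv_onRel (g : L.Γ) {n : ℕ+} (R : L.Rel n) :
    L.onRel g⁻¹ (L.onRel g R) = R := by rw [← onRel_mul]; simp

@[simp] theorem onRel_onRel_inv (g : L.Γ) {n : ℕ+} (R : L.Rel n) :
    L.onRel g (L.onRel g⁻¹ R) = R := by rw [← onRel_mul]; simp

@[simp] theorem onFn_inv_onFn (g : L.Γ) (F : L.Fn) : L.onFn g⁻¹ (L.onFn g F) = F := by
  rw [← onFn_mul]; simp

@[simp] theorem onFn_onFn_inv (g : L.Γ) (F : L.Fn) : L.onFn g (L.onFn g⁻¹ F) = F := by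
  rw [← onFn_mul]; simp

theorem IsEmbedding.comp {A : Str L V} {B : Str L W} {C : Str L Y} {g h : L.Γ} {e : V → W}
    {f : W → Y} (hf : B.IsEmbedding C g f) (he : A.IsEmbedding B h e) :
    A.IsEmbedding C (g * h) (f ∘ e) where
  injective := hf.injective.comp he.injective
  map_rel R x := by rw [he.map_rel, hf.map_rel, onRel_mul]; rfl
  map_fn F x := by rw [Set.image_comp, he.map_fn, hf.map_fn, onFn_mul]; rfl

/-- An embedding whose values lie in the image of another embedding factors through it. -/
theorem IsEmbedding.factor {A : Str L V} {B : Str L W} {C : Str L Y} {g k : L.Γ} {e : V → W}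
    {f : Y → W} {h : Y → V} (he : A.IsEmbedding B k e) (hf : C.IsEmbedding B g f)
    (hh : ∀ y, f y = e (h y)) : C.IsEmbedding A (k⁻¹ * g) h where
  injective a b hab := hf.injective (by rw [hh, hh, hab])
  map_rel R x := by
    rw [hf.map_rel, he.map_rel, onRel_mul, onRel_onRel_inv]
    have : f ∘ x = e ∘ h ∘ x := by ext i; exact hh _
    rw [this]
  map_fn F x := by
    apply he.injective.image_injective
    rw [he.map_fn, onFn_mul, onFn_onFn_inv, ← hh, ← hf.map_fn, ← Set.image_comp]
    exact Set.image_congr fun y _ => (hh y).symm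

theorem isEmbedding_induce (A : Str L V) {S : Set V} (hS : A.IsClosed S) :
    (A.induce S).IsEmbedding A 1 (Subtype.val : S → V) where
  injective := Subtype.val_injective
  map_rel R x := Iff.rfl
  map_fn F x := by
    ext y
    simp only [Set.mem_image, onFn_one]
    constructor
    · rintro ⟨z, hz, rfl⟩; exact hz
    · intro hy; exact ⟨⟨y, hS F x x.2 hy⟩, hy, rfl⟩

theorem IsEmbedding.symm {A : Str L V} {B : Str L W} {g : L.Γ} {e : V ≃ W}
    (he : A.IsEmbedding B g e) : B.IsEmbedding A g⁻¹ e.symm where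
  injective := e.symm.injective
  map_rel R x := by
    rw [he.map_rel, onRel_onRel_inv]
    have : e ∘ e.symm ∘ x = x := by ext i; simp
    rw [this]
  map_fn F x := by
    apply e.injective.image_injective
    rw [he.map_fn, onFn_onFn_inv, ← Set.image_comp]
    simp

/-- The vertex set of the substructure generated by a vertex. -/
def cl (A : Str L V) (x : V) : Set V := {y | ∀ S : Set V, A.IsClosed S → x ∈ S → y ∈ S}

theorem mem_cl_self (A : Str L V) (x : V) : x ∈ A.cl x := fun _ _ h => h

theorem cl_subset {A : Str L V} {x : V} {S : Set V} (hS : A.IsClosed S) (hx : x ∈ S) :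
    A.cl x ⊆ S := fun _ hy => hy S hS hx

theorem isClosed_cl (A : Str L V) (x : V) : A.IsClosed (A.cl x) :=
  fun F y hy _ hz S hS hx => hS F y (hy S hS hx) hz

theorem cl_subset_cl {A : Str L V} {x y : V} (h : y ∈ A.cl x) : A.cl y ⊆ A.cl x :=
  cl_subset (A.isClosed_cl x) h

/-- The identity of a substructure. -/
def PartialAut.refl (A : Str L V) {S : Set V} (hS : A.IsClosed S) : A.PartialAut where
  perm := 1
  dom := S
  cod := S
  dom_closed := hS
  cod_closed := hS
  toEquiv := Equiv.refl S
  isEmbedding := ⟨Function.injective_id, fun _ _ => Iff.rfl, fun _ _ => by simp⟩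

/-- The inverse of a partial automorphism. -/
def PartialAut.symm {A : Str L V} (f : A.PartialAut) : A.PartialAut where
  perm := f.perm⁻¹
  dom := f.cod
  cod := f.dom
  dom_closed := f.cod_closed
  cod_closed := f.dom_closed
  toEquiv := f.toEquiv.symm
  isEmbedding := f.isEmbedding.symm

theorem PartialAut.refl_coherent (A : Str L V) {S : Set V} (hS : A.IsClosed S) :
    (refl A hS).IsCoherentTriple (refl A hS) (refl A hS) where
  dom_eq := rfl
  mid_eq := rfl
  cod_eq := rfl
  perm_eq := by simp [refl]
  map_eq x y z hzx hy := by
    change (z : V) = y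
    exact hzx.trans hy.symm

theorem PartialAut.symm_coherent {A : Str L V} (f : A.PartialAut) :
    f.IsCoherentTriple f.symm (refl A f.dom_closed) where
  dom_eq := rfl
  mid_eq := rfl
  cod_eq := rfl
  perm_eq := by simp [refl, symm]
  map_eq x y z hzx hy := by
    have h1 : y = f.toEquiv x := Subtype.ext hy
    subst h1
    change (z : V) = (f.toEquiv.symm (f.toEquiv x) : V)
    simp [hzx]

theorem PartialAut.mem_rel_iff {A : Str L V} (f : A.PartialAut) {n : ℕ+} (R : L.Rel n)
    (x : Fin (n : ℕ) → f.dom) :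
    (fun i => (x i : V)) ∈ A.rel R ↔ (fun i => (f.toEquiv (x i) : V)) ∈ A.rel (L.onRel f.perm R) :=
  f.isEmbedding.map_rel R x

theorem PartialAut.image_fn {A : Str L V} (f : A.PartialAut) (F : L.Fn) (x : f.dom) :
    (fun y : f.dom => (f.toEquiv y : V)) '' {y | (y : V) ∈ A.fn F x} =
      A.fn (L.onFn f.perm F) (f.toEquiv x) := by
  have := ((A.isEmbedding_induce f.cod_closed).comp f.isEmbedding).map_fn F x
  rwa [one_mul] at this

/-- Partial automorphisms map generated substructures to generated substructures. -/
theorem PartialAut.map_mem_cl {A : Str L V} (f : A.PartialAut) (x y : f.dom)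
    (h : (y : V) ∈ A.cl x) : (f.toEquiv y : V) ∈ A.cl (f.toEquiv x) := by
  have hc : A.IsClosed ((fun z : f.dom => (z : V)) '' {z | (f.toEquiv z : V) ∈ A.cl (f.toEquiv x)}) := by
    rintro F _ ⟨z, hz, rfl⟩ w hw
    have hw' : w ∈ f.dom := f.dom_closed F z z.2 hw
    refine ⟨⟨w, hw'⟩, ?_, rfl⟩
    refine A.isClosed_cl _ (L.onFn f.perm F) _ hz ?_
    rw [← f.image_fn]
    exact ⟨⟨w, hw'⟩, hw, rfl⟩
  obtain ⟨z, hz, hzy⟩ := cl_subset hc ⟨x, A.mem_cl_self _, rfl⟩ h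
  rwa [← Subtype.ext hzy]

theorem PartialAut.cl_subset_dom {A : Str L V} (f : A.PartialAut) (x : f.dom) :
    A.cl x ⊆ f.dom := cl_subset f.dom_closed x.2

theorem PartialAut.map_mem_cl_symm {A : Str L V} (f : A.PartialAut) (x : f.dom) (y : f.cod)
    (h : (y : V) ∈ A.cl (f.toEquiv x)) : (f.toEquiv.symm y : V) ∈ A.cl x := by
  have h' : (f.toEquiv.symm y : V) ∈ A.cl (f.toEquiv.symm (f.toEquiv x)) :=
    f.symm.map_mem_cl (f.toEquiv x) y h
  rwa [Equiv.symm_apply_apply] at h'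

end Str

/-! ### Functorial extension of partial injections -/

/-- A set of pairs which is the graph of a partial injection. -/
def IsPartialInj {X Y : Type*} (r : Set (X × Y)) : Prop :=
  ∀ p ∈ r, ∀ q ∈ r, p.1 = q.1 ↔ p.2 = q.2

/-- Partial injections of a finite set extend to permutations in a functorial way. -/
theorem exists_coherent_extension (X : Type*) [Finite X] :
    ∃ ext : Set (X × X) → Equiv.Perm X,
      (∀ r, IsPartialInj r → ∀ p ∈ r, ext r p.1 = p.2) ∧
      (∀ r s t, IsPartialInj r → IsPartialInj s → Prod.snd '' r = Prod.fst '' s →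
        t = {p | ∃ y, (p.1, y) ∈ r ∧ (y, p.2) ∈ s} → ext t = ext s * ext r) := by
  classical
  have := Fintype.ofFinite X
  -- The complement of each set is numbered once and for all. Points outside the domain go to the
  -- points outside the range with the same number, so the rule is compatible with composition.
  have hβ : ∀ S : Set X, Nonempty (((Sᶜ : Set X) : Type _) ≃ Fin (Fintype.card X - Nat.card S)) := by
    intro S
    refine Finite.card_eq.1 ?_
    rw [Nat.card_fin, ← Nat.card_eq_fintype_card]
    have := Nat.card_congr (Equiv.Set.sumCompl S)
    rw [Nat.card_sum] at this
    omega
  let β := fun S => (hβ S).some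
  clear_value β
  have main : ∀ r : Set (X × X), IsPartialInj r → ∃ e : Equiv.Perm X, (∀ p ∈ r, e p.1 = p.2) ∧
      ∀ x : ((Prod.fst '' r)ᶜ : Set X), ∃ y : ((Prod.snd '' r)ᶜ : Set X), e x = y ∧
        (β _ x : ℕ) = β _ y := by
    intro r hr
    let a : r ≃ (Prod.fst '' r : Set X) := Equiv.ofBijective (fun p => ⟨p.1.1, p.1, p.2, rfl⟩) (by
      constructor
      · intro p q hpq
        have h1 : p.1.1 = q.1.1 := congrArg Subtype.val hpq
        exact Subtype.ext (Prod.ext h1 ((hr _ p.2 _ q.2).1 h1))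
      · rintro ⟨_, p, hp, rfl⟩; exact ⟨⟨p, hp⟩, rfl⟩)
    let b : r ≃ (Prod.snd '' r : Set X) := Equiv.ofBijective (fun p => ⟨p.1.2, p.1, p.2, rfl⟩) (by
      constructor
      · intro p q hpq
        have h1 : p.1.2 = q.1.2 := congrArg Subtype.val hpq
        exact Subtype.ext (Prod.ext ((hr _ p.2 _ q.2).2 h1) h1)
      · rintro ⟨_, p, hp, rfl⟩; exact ⟨⟨p, hp⟩, rfl⟩)
    have hcard : Nat.card (Prod.fst '' r : Set X) = Nat.card (Prod.snd '' r : Set X) :=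
      Nat.card_congr (a.symm.trans b)
    let c : ((Prod.fst '' r)ᶜ : Set X) ≃ ((Prod.snd '' r)ᶜ : Set X) :=
      ((β _).trans (finCongr (by rw [hcard]))).trans (β _).symm
    refine ⟨(Equiv.Set.sumCompl (Prod.fst '' r)).symm.trans
      (((a.symm.trans b).sumCongr c).trans (Equiv.Set.sumCompl (Prod.snd '' r))), ?_, ?_⟩
    · intro p hp
      have h1 : (Equiv.Set.sumCompl (Prod.fst '' r)).symm p.1 = Sum.inl (a ⟨p, hp⟩) := by
        rw [Equiv.symm_apply_eq]; rfl
      simp only [Equiv.trans_apply, h1]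
      simp only [Equiv.sumCongr_apply, Sum.map_inl, Equiv.trans_apply, Equiv.symm_apply_apply,
        Equiv.Set.sumCompl_apply_inl]
      rfl
    · intro x
      refine ⟨c x, ?_, ?_⟩
      · have h1 : (Equiv.Set.sumCompl (Prod.fst '' r)).symm x = Sum.inr x := by
          rw [Equiv.symm_apply_eq]; rfl
        simp only [Equiv.trans_apply, h1]
        simp
      · exact (congrArg Fin.val ((β (Prod.snd '' r)).apply_symm_apply
          (finCongr (by rw [hcard]) (β (Prod.fst '' r) x)))).symm
  choose! ext hext1 hext2 using main
  refine ⟨ext, hext1, ?_⟩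
  intro r s t hr hs hrs ht
  have hdom : Prod.fst '' t = Prod.fst '' r := by
    ext x
    constructor
    · rintro ⟨p, hp, rfl⟩
      rw [ht] at hp
      obtain ⟨y, hy, -⟩ := hp
      exact ⟨_, hy, rfl⟩
    · rintro ⟨p, hp, rfl⟩
      obtain ⟨q, hq, hpq⟩ : p.2 ∈ Prod.fst '' s := hrs ▸ ⟨p, hp, rfl⟩
      refine ⟨(p.1, q.2), ?_, rfl⟩
      rw [ht]
      exact ⟨p.2, hp, by rw [← hpq]; exact hq⟩
  have hcod : Prod.snd '' t = Prod.snd '' s := by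
    ext x
    constructor
    · rintro ⟨p, hp, rfl⟩
      rw [ht] at hp
      obtain ⟨y, -, hy⟩ := hp
      exact ⟨_, hy, rfl⟩
    · rintro ⟨p, hp, rfl⟩
      obtain ⟨q, hq, hpq⟩ : p.1 ∈ Prod.snd '' r := hrs ▸ ⟨p, hp, rfl⟩
      refine ⟨(q.1, p.2), ?_, rfl⟩
      rw [ht]
      exact ⟨p.1, by rw [← hpq]; exact hq, hp⟩
  have hti : IsPartialInj t := by
    rw [ht]
    rintro p ⟨y, hy1, hy2⟩ q ⟨z, hz1, hz2⟩
    exact (hr _ hy1 _ hz1).trans (hs _ hy2 _ hz2)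
  have hβ' : ∀ {S T : Set X} (h : S = T) (x : (Sᶜ : Set X)) (y : (Tᶜ : Set X)), (x : X) = y →
      (β S x : ℕ) = β T y := by
    rintro S _ rfl x y hxy
    rw [Subtype.ext hxy]
  have hβi : ∀ {S T : Set X} (h : S = T) (x : (Sᶜ : Set X)) (y : (Tᶜ : Set X)),
      (β S x : ℕ) = β T y → (x : X) = y := by
    rintro S _ rfl x y hxy
    rw [(β S).injective (Fin.ext hxy)]
  ext x
  by_cases hx : x ∈ Prod.fst '' r
  · obtain ⟨p, hp, hpx⟩ := hdom ▸ hx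
    have hp' := hp
    rw [ht] at hp'
    obtain ⟨y, hy1, hy2⟩ := hp'
    have e1 := hext1 _ hr _ hy1
    have e2 := hext1 _ hs _ hy2
    have e3 := hext1 _ hti _ hp
    simp only at e1 e2
    rw [Equiv.Perm.mul_apply, ← hpx, e3, e1, e2]
  · obtain ⟨y, hy, hβy⟩ := hext2 r hr ⟨x, hx⟩
    obtain ⟨z, hz, hβz⟩ := hext2 s hs ⟨y, by rw [← hrs]; exact y.2⟩
    obtain ⟨w, hw, hβw⟩ := hext2 t hti ⟨x, by rw [hdom]; exact hx⟩
    simp only at hy hz hw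
    rw [Equiv.Perm.mul_apply, hy, hz, hw]
    refine hβi hcod _ _ ?_
    rw [← hβw, ← hβz, hβ' hdom ⟨x, _⟩ ⟨x, hx⟩ rfl, hβy]
    exact hβ' hrs _ _ rfl

/-- A functorial extension of partial injections of a finite set to permutations. -/
noncomputable def extendPerm {X : Type*} [Finite X] : Set (X × X) → Equiv.Perm X :=
  (exists_coherent_extension X).choose

theorem extendPerm_apply {X : Type*} [Finite X] {r : Set (X × X)} (hr : IsPartialInj r) {x y : X}
    (h : (x, y) ∈ r) : extendPerm r x = y :=
  (exists_coherent_extension X).choose_spec.1 r hr _ h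

theorem extendPerm_comp {X : Type*} [Finite X] {r s t : Set (X × X)} (hr : IsPartialInj r)
    (hs : IsPartialInj s) (hrs : Prod.snd '' r = Prod.fst '' s)
    (ht : t = {p | ∃ y, (p.1, y) ∈ r ∧ (y, p.2) ∈ s}) :
    extendPerm t = extendPerm s * extendPerm r :=
  (exists_coherent_extension X).choose_spec.2 r s t hr hs hrs ht

end EPPA

/-! ### Atlases of charts and their refinement by labels -/

namespace EPPA

open Str

universe u₁ u₂ u₃ u₄ u₅ u₆

variable {L : PermLanguage.{u₁, u₂}} {V : Type u₃} {A : Str L V}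

/-- A finite set covered by charts, that is, injective copies of the vertex set of `A` with a
language part, such that the partial isomorphisms between charts that are induced by the partial
automorphisms of `A` extend in a functorial way to permutations which preserve charts. -/
structure Level (A : Str L V) where
  B : Type u₄
  finite : Finite B
  E : Type u₅
  perm : E → L.Γ
  map : E → V → B
  injective : ∀ ε, Function.Injective (map ε)
  pt : E
  perm_pt : perm pt = 1
  Φ : E → E → A.PartialAut → Equiv.Perm B
  Φ_map : ∀ ε₁ ε₂ (f : A.PartialAut) (x : f.dom), Φ ε₁ ε₂ f (map ε₁ x) = map ε₂ (f.toEquiv x)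
  Φ_chart : ∀ ε₁ ε₂ f ε, ∃ ε', perm ε' = perm ε₂ * f.perm * (perm ε₁)⁻¹ * perm ε ∧
    ∀ x, Φ ε₁ ε₂ f (map ε x) = map ε' x
  Φ_coherent : ∀ ε₁ ε₂ ε₃ (f g h : A.PartialAut), f.IsCoherentTriple g h →
    Φ ε₁ ε₃ h = Φ ε₂ ε₃ g * Φ ε₁ ε₂ f

namespace Level

variable (ℒ : Level.{u₁, u₂, u₃, u₄, u₅} A)

/-- The identity composed with itself is a coherent triple, so the permutation is an idempotent of a
group. -/
theorem Φ_refl (ε : ℒ.E) {S : Set V} (hS : A.IsClosed S) :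
    ℒ.Φ ε ε (PartialAut.refl A hS) = 1 := by
  have := ℒ.Φ_coherent ε ε ε _ _ _ (PartialAut.refl_coherent A hS)
  simpa using this

theorem Φ_symm_mul (ε₁ ε₂ : ℒ.E) (f : A.PartialAut) :
    ℒ.Φ ε₂ ε₁ f.symm * ℒ.Φ ε₁ ε₂ f = 1 := by
  rw [← ℒ.Φ_coherent ε₁ ε₂ ε₁ _ _ _ f.symm_coherent, Φ_refl]

theorem Φ_symm (ε₁ ε₂ : ℒ.E) (f : A.PartialAut) :
    ℒ.Φ ε₂ ε₁ f.symm = (ℒ.Φ ε₁ ε₂ f)⁻¹ :=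
  eq_inv_of_mul_eq_one_left (ℒ.Φ_symm_mul ε₁ ε₂ f)

theorem exists_chart_Φ_inv (ε₁ ε₂ : ℒ.E) (f : A.PartialAut) (ε : ℒ.E) :
    ∃ ε', ∀ x, (ℒ.Φ ε₁ ε₂ f)⁻¹ (ℒ.map ε x) = ℒ.map ε' x := by
  obtain ⟨ε', -, h⟩ := ℒ.Φ_chart ε₂ ε₁ f.symm ε
  rw [Φ_symm] at h
  exact ⟨ε', h⟩

/-- The charts induce the same structure on their overlaps. -/
structure Compat : Prop where
  rel : ∀ (ε ε' : ℒ.E) {n : ℕ+} (R : L.Rel n) (x y : Fin (n : ℕ) → V),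
    (∀ i, ℒ.map ε (x i) = ℒ.map ε' (y i)) → x ∈ A.rel (L.onRel (ℒ.perm ε)⁻¹ R) →
      y ∈ A.rel (L.onRel (ℒ.perm ε')⁻¹ R)
  fn : ∀ (ε ε' : ℒ.E) (F : L.Fn) (x y z : V), ℒ.map ε x = ℒ.map ε' y →
    z ∈ A.fn (L.onFn (ℒ.perm ε)⁻¹ F) x →
      ∃ w ∈ A.fn (L.onFn (ℒ.perm ε')⁻¹ F) y, ℒ.map ε z = ℒ.map ε' w

variable {ℒ}

theorem Compat.exists_mem_cl (h : ℒ.Compat) {ε ε' : ℒ.E} {x y z : V}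
    (hxy : ℒ.map ε x = ℒ.map ε' y) (hz : z ∈ A.cl x) :
    ∃ w ∈ A.cl y, ℒ.map ε z = ℒ.map ε' w := by
  have hc : A.IsClosed {z | ∃ w ∈ A.cl y, ℒ.map ε z = ℒ.map ε' w} := by
    rintro F z ⟨w, hw, hzw⟩ u hu
    obtain ⟨v, hv, huv⟩ := h.fn ε ε' (L.onFn (ℒ.perm ε) F) z w u hzw (by simpa using hu)
    exact ⟨v, A.isClosed_cl y _ w hw hv, huv⟩
  exact cl_subset hc ⟨y, A.mem_cl_self y, hxy⟩ hz

/-- The partial automorphism given by the overlap of two charts. -/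
theorem Compat.exists_overlap (h : ℒ.Compat) (ε ε' : ℒ.E) :
    ∃ f : A.PartialAut, f.perm = (ℒ.perm ε')⁻¹ * ℒ.perm ε ∧
      (∀ x y, ℒ.map ε x = ℒ.map ε' y → x ∈ f.dom) ∧
      ∀ x : f.dom, ℒ.map ε x = ℒ.map ε' (f.toEquiv x) := by
  have hcl : ∀ ε ε' : ℒ.E, A.IsClosed {x | ∃ y, ℒ.map ε x = ℒ.map ε' y} := by
    rintro ε ε' F x ⟨y, hxy⟩ z hz
    obtain ⟨w, -, hw⟩ := h.fn ε ε' (L.onFn (ℒ.perm ε) F) x y z hxy (by simpa using hz)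
    exact ⟨w, hw⟩
  choose a ha using fun x : {x | ∃ y, ℒ.map ε x = ℒ.map ε' y} => x.2
  choose b hb using fun x : {x | ∃ y, ℒ.map ε' x = ℒ.map ε y} => x.2
  refine ⟨⟨(ℒ.perm ε')⁻¹ * ℒ.perm ε, {x | ∃ y, ℒ.map ε x = ℒ.map ε' y},
    {x | ∃ y, ℒ.map ε' x = ℒ.map ε y}, hcl _ _, hcl _ _,
    ⟨fun x => ⟨a x, x, (ha x).symm⟩, fun x => ⟨b x, x, (hb x).symm⟩, ?_, ?_⟩, ?_, ?_, ?_⟩, rfl,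
    fun x y h => ⟨y, h⟩, ha⟩
  · intro x
    exact Subtype.ext (ℒ.injective ε ((hb ⟨a x, x, (ha x).symm⟩).symm.trans (ha x).symm))
  · intro x
    exact Subtype.ext (ℒ.injective ε' ((ha ⟨b x, x, (hb x).symm⟩).symm.trans (hb x).symm))
  · exact Equiv.injective _
  · intro n R x
    constructor
    · intro hx
      have := h.rel ε ε' (L.onRel (ℒ.perm ε) R) (fun i => x i) (fun i => a (x i))
        (fun i => ha (x i)) (by rw [onRel_inv_onRel]; exact hx)
      rwa [← onRel_mul] at this
    · intro hx
      have := h.rel ε' ε (L.onRel (ℒ.perm ε) R) (fun i => a (x i)) (fun i => x i)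
        (fun i => (ha (x i)).symm) (by rw [← onRel_mul]; exact hx)
      rwa [onRel_inv_onRel] at this
  · intro F x
    ext y
    constructor
    · rintro ⟨z, hz, rfl⟩
      obtain ⟨w, hw, hzw⟩ := h.fn ε ε' (L.onFn (ℒ.perm ε) F) x (a x) z (ha x)
        (by rw [onFn_inv_onFn]; exact hz)
      have : w = a z := ℒ.injective ε' (hzw.symm.trans (ha z))
      subst this
      rwa [← onFn_mul] at hw
    · intro hy
      obtain ⟨w, hw, hyw⟩ := h.fn ε' ε (L.onFn (ℒ.perm ε) F) (a x) x y (ha x).symm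
        (by rw [← onFn_mul]; exact hy)
      rw [onFn_inv_onFn] at hw
      refine ⟨⟨w, y, hyw.symm⟩, hw, Subtype.ext (ℒ.injective ε' ?_)⟩
      exact (ha ⟨w, y, hyw.symm⟩).symm.trans hyw.symm

end Level

/-- Finitely many labels for the vertices of a level together with a notion of admissible labelling
of charts, such that the permutations of the level lift to the set of labelled vertices. -/
structure Scheme (ℒ : Level.{u₁, u₂, u₃, u₄, u₅} A) where
  Lab : Type u₆
  finite : Finite Lab
  Gen : ℒ.E → (V → Lab) → Prop
  exists_gen : ∃ l, Gen ℒ.pt l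
  T : {q : ℒ.E × (V → Lab) // Gen q.1 q.2} → {q : ℒ.E × (V → Lab) // Gen q.1 q.2} →
    A.PartialAut → Equiv.Perm (ℒ.B × Lab)
  T_map : ∀ q₁ q₂ (f : A.PartialAut) (x : f.dom), T q₁ q₂ f (ℒ.map q₁.1.1 x, q₁.1.2 x) =
    (ℒ.map q₂.1.1 (f.toEquiv x), q₂.1.2 (f.toEquiv x))
  T_chart : ∀ q₁ q₂ f (q : {q : ℒ.E × (V → Lab) // Gen q.1 q.2}),
    ∃ q' : {q : ℒ.E × (V → Lab) // Gen q.1 q.2},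
    ℒ.perm q'.1.1 = ℒ.perm q₂.1.1 * f.perm * (ℒ.perm q₁.1.1)⁻¹ * ℒ.perm q.1.1 ∧
      ∀ x, T q₁ q₂ f (ℒ.map q.1.1 x, q.1.2 x) = (ℒ.map q'.1.1 x, q'.1.2 x)
  T_coherent : ∀ q₁ q₂ q₃ (f g h : A.PartialAut), f.IsCoherentTriple g h →
    T q₁ q₃ h = T q₂ q₃ g * T q₁ q₂ f

namespace Scheme

variable {ℒ : Level.{u₁, u₂, u₃, u₄, u₅} A} (S : Scheme.{u₁, u₂, u₃, u₄, u₅, u₆} ℒ)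

/-- The charts together with an admissible labelling. -/
abbrev LChart := {q : ℒ.E × (V → S.Lab) // S.Gen q.1 q.2}

/-- The labelled vertex given by a vertex of a labelled chart. -/
def lmap (q : S.LChart) (x : V) : ℒ.B × S.Lab := (ℒ.map q.1.1 x, q.1.2 x)

theorem lmap_injective (q : S.LChart) : Function.Injective (S.lmap q) :=
  fun _ _ h => ℒ.injective _ (congrArg Prod.fst h)

/-- The level given by the labellings of the substructures generated by a vertex. -/
noncomputable def step : Level.{u₁, u₂, u₃, max u₄ u₆, max u₃ u₅ u₆} A where
  -- The second component stores the labels on the whole generated substructure: charts meeting in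
  -- one vertex must also meet in the values of the functions there.
  B := (ℒ.B × S.Lab) × Set (ℒ.B × S.Lab)
  finite := by
    have := ℒ.finite
    have := S.finite
    infer_instance
  E := S.LChart
  perm q := ℒ.perm q.1.1
  map q x := (S.lmap q x, S.lmap q '' A.cl x)
  injective q x y h := S.lmap_injective q (congrArg Prod.fst h)
  pt := ⟨(ℒ.pt, S.exists_gen.choose), S.exists_gen.choose_spec⟩
  perm_pt := ℒ.perm_pt
  Φ q₁ q₂ f := (S.T q₁ q₂ f).prodCongr (Equiv.Set.congr (S.T q₁ q₂ f))
  Φ_map q₁ q₂ f x := by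
    refine Prod.ext (S.T_map q₁ q₂ f x) ?_
    change S.T q₁ q₂ f '' (S.lmap q₁ '' A.cl x) = S.lmap q₂ '' A.cl (f.toEquiv x)
    ext z
    constructor
    · rintro ⟨_, ⟨y, hy, rfl⟩, rfl⟩
      have hy' : y ∈ f.dom := f.cl_subset_dom x hy
      exact ⟨f.toEquiv ⟨y, hy'⟩, f.map_mem_cl x ⟨y, hy'⟩ hy, (S.T_map q₁ q₂ f ⟨y, hy'⟩).symm⟩
    · rintro ⟨y, hy, rfl⟩
      have hy' : y ∈ f.cod := f.symm.cl_subset_dom (f.toEquiv x) hy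
      refine ⟨_, ⟨f.toEquiv.symm ⟨y, hy'⟩, f.map_mem_cl_symm x ⟨y, hy'⟩ hy, rfl⟩, ?_⟩
      refine (S.T_map q₁ q₂ f _).trans ?_
      simp [lmap]
  Φ_chart q₁ q₂ f q := by
    obtain ⟨q', hp, hq⟩ := S.T_chart q₁ q₂ f q
    refine ⟨q', hp, fun x => Prod.ext (hq x) ?_⟩
    change S.T q₁ q₂ f '' (S.lmap q '' A.cl x) = S.lmap q' '' A.cl x
    rw [← Set.image_comp]
    exact Set.image_congr fun y _ => hq y
  Φ_coherent q₁ q₂ q₃ f g h hc := by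
    have := S.T_coherent q₁ q₂ q₃ f g h hc
    ext1 z
    refine Prod.ext ?_ ?_
    · change S.T q₁ q₃ h z.1 = _
      rw [this]; rfl
    · change S.T q₁ q₃ h '' z.2 = S.T q₂ q₃ g '' (S.T q₁ q₂ f '' z.2)
      rw [this, ← Set.image_comp]; rfl

/-- The projection from the level given by a labelling scheme. -/
def proj (b : S.step.B) : ℒ.B := b.1.1

theorem lmap_eq_of_map_eq {q q' : S.LChart} {x y : V} (h : S.step.map q x = S.step.map q' y) :
    S.lmap q x = S.lmap q' y := congrArg Prod.fst h

theorem exists_lmap_eq {q q' : S.LChart} {x y z : V} (h : S.step.map q x = S.step.map q' y)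
    (hz : z ∈ A.cl x) : ∃ w ∈ A.cl y, S.lmap q z = S.lmap q' w := by
  have h2 : S.lmap q '' A.cl x = S.lmap q' '' A.cl y := congrArg Prod.snd h
  obtain ⟨w, hw, hzw⟩ := h2 ▸ Set.mem_image_of_mem (S.lmap q) hz
  exact ⟨w, hw, hzw.symm⟩

/-- If the labels determine the structure, the level given by a labelling scheme is compatible. -/
theorem compat_step
    (hrel : ∀ (q q' : S.LChart) {n : ℕ+} (R : L.Rel n) (x y : Fin (n : ℕ) → V),
      (∀ i, S.lmap q (x i) = S.lmap q' (y i)) → x ∈ A.rel (L.onRel (ℒ.perm q.1.1)⁻¹ R) →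
        y ∈ A.rel (L.onRel (ℒ.perm q'.1.1)⁻¹ R))
    (hfn : ∀ (q q' : S.LChart) (F : L.Fn) (x y z : V), S.lmap q x = S.lmap q' y →
      z ∈ A.fn (L.onFn (ℒ.perm q.1.1)⁻¹ F) x →
        ∃ w ∈ A.fn (L.onFn (ℒ.perm q'.1.1)⁻¹ F) y, ℒ.map q.1.1 z = ℒ.map q'.1.1 w) :
    S.step.Compat where
  rel q q' n R x y hxy := hrel q q' R x y fun i => S.lmap_eq_of_map_eq (hxy i)
  fn q q' F x y z hxy hz := by
    -- `hfn` matches function values only in the lower level. Their labels match because the shared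
    -- vertex remembers them, and it remains to match the labelled substructures they generate; this
    -- is an argument on a closed subset of `A.cl x`.
    have key : ∀ (q q' : S.LChart) (x y : V), S.step.map q x = S.step.map q' y →
        ∀ z ∈ A.cl x, ∀ w ∈ A.cl y, S.lmap q z = S.lmap q' w →
          S.lmap q '' A.cl z ⊆ S.lmap q' '' A.cl w := by
      intro q q' x y hxy z hz w hw hzw
      have hc : A.IsClosed {u ∈ A.cl x | S.lmap q u ∈ S.lmap q' '' A.cl w} := by
        rintro F u ⟨hu, u', hu', huu⟩ v hv
        have hvx := A.isClosed_cl x F u hu hv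
        refine ⟨hvx, ?_⟩
        obtain ⟨v', hv', hvv⟩ := S.exists_lmap_eq hxy hvx
        obtain ⟨v'', hv'', h2⟩ := hfn q q' (L.onFn (ℒ.perm q.1.1) F) u u' v huu.symm
          (by rw [onFn_inv_onFn]; exact hv)
        have : v' = v'' := ℒ.injective _ ((congrArg Prod.fst hvv).symm.trans h2)
        subst this
        exact ⟨v', A.isClosed_cl w _ u' hu' hv'', hvv.symm⟩
      rintro _ ⟨u, hu, rfl⟩
      exact (cl_subset hc ⟨hz, w, A.mem_cl_self w, hzw.symm⟩ hu).2
    have hzx := A.isClosed_cl x _ x (A.mem_cl_self x) hz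
    obtain ⟨w', hw'y, hw'⟩ := S.exists_lmap_eq hxy hzx
    obtain ⟨w, hw, hzw⟩ := hfn q q' F x y z (S.lmap_eq_of_map_eq hxy) hz
    have : w' = w := ℒ.injective _ ((congrArg Prod.fst hw').symm.trans hzw)
    subst this
    exact ⟨w', hw, Prod.ext hw' (Set.Subset.antisymm (key q q' x y hxy z hzx w' hw'y hw')
      (key q' q y x hxy.symm w' hw'y z hzx hw'.symm))⟩

theorem compat_step_of_compat (h : ℒ.Compat) : S.step.Compat :=
  S.compat_step (fun q q' _ R x y hxy => h.rel q.1.1 q'.1.1 R x y fun i =>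
    congrArg Prod.fst (hxy i)) fun q q' F x y z hxy =>
    h.fn q.1.1 q'.1.1 F x y z (congrArg Prod.fst hxy)

end Scheme

end EPPA

/-! ### Colour patterns and the elimination of bad cliques -/

namespace EPPA

open Str

universe u₁ u₂ u₃ u₄ u₅ u₆

section ColourGraph

variable {I J : Type*} {q : ℕ}

/-- The partial map of colours which sends `a i` to `b i` and fixes `none`. -/
def colourGraph (a b : I → Option (Fin q)) : Set (Option (Fin q) × Option (Fin q)) :=
  insert (none, none) (Set.range fun i => (a i, b i))

theorem isPartialInj_colourGraph {a b : I → Option (Fin q)}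
    (h0 : ∀ i, a i = none ↔ b i = none)
    (h : ∀ i j, a i ≠ none → a j ≠ none → (a i = a j ↔ b i = b j)) :
    IsPartialInj (colourGraph a b) := by
  rintro p (rfl | ⟨i, rfl⟩) p' (rfl | ⟨j, rfl⟩)
  · simp
  · simpa [eq_comm] using h0 j
  · simpa using h0 i
  · by_cases hi : a i = none
    · have hi' := (h0 i).1 hi
      have := h0 j
      simp only [hi, hi']
      rw [eq_comm, this, eq_comm]
    · by_cases hj : a j = none
      · have hj' := (h0 j).1 hj
        have := h0 i
        simp only [hj, hj']
        exact this
      · exact h i j hi hj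

/-- Lets the colour maps of a coherent triple, indexed by three different domains, be compared over
one index set. -/
theorem colourGraph_comp_surjective {a b : I → Option (Fin q)} {s : J → I}
    (hs : Function.Surjective s) :
    colourGraph (fun j => a (s j)) (fun j => b (s j)) = colourGraph a b := by
  unfold colourGraph
  congr 1
  exact hs.range_comp (fun i => (a i, b i))

theorem snd_image_colourGraph (a b : I → Option (Fin q)) :
    Prod.snd '' colourGraph a b = insert none (Set.range b) := by
  rw [colourGraph, Set.image_insert_eq, ← Set.range_comp]; rfl

theorem fst_image_colourGraph (a b : I → Option (Fin q)) :
    Prod.fst '' colourGraph a b = insert none (Set.range a) := by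
  rw [colourGraph, Set.image_insert_eq, ← Set.range_comp]; rfl

theorem extendPerm_colourGraph {a b c : I → Option (Fin q)} (hab : IsPartialInj (colourGraph a b))
    (hbc : IsPartialInj (colourGraph b c)) :
    extendPerm (colourGraph a c) =
      extendPerm (colourGraph b c) * extendPerm (colourGraph a b) := by
  refine extendPerm_comp hab hbc (by rw [snd_image_colourGraph, fst_image_colourGraph]) ?_
  ext p
  constructor
  · rintro (rfl | ⟨i, rfl⟩)
    · exact ⟨none, Or.inl rfl, Or.inl rfl⟩
    · exact ⟨b i, Or.inr ⟨i, rfl⟩, Or.inr ⟨i, rfl⟩⟩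
  · rintro ⟨y, hy, hy'⟩
    rcases hy with hy | ⟨i, hi⟩
    · obtain ⟨h1, h2⟩ := Prod.ext_iff.1 hy
      have := (hbc _ hy' (none, none) (Or.inl rfl)).1 h2
      exact Or.inl (Prod.ext h1 this)
    · obtain ⟨h1, h2⟩ := Prod.ext_iff.1 hi
      have := (hbc _ hy' (b i, c i) (Or.inr ⟨i, rfl⟩)).1 h2.symm
      exact Or.inr ⟨i, Prod.ext h1 this.symm⟩

end ColourGraph

variable {L : PermLanguage.{u₁, u₂}} {V : Type u₃} {A : Str L V}

namespace Level

variable (ℒ : Level.{u₁, u₂, u₃, u₄, u₅} A)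

/-- Two vertices are adjacent if they lie in a common chart. -/
def Adj (b b' : ℒ.B) : Prop := ∃ ε x y, ℒ.map ε x = b ∧ ℒ.map ε y = b'

/-- Sets of pairwise adjacent vertices which are covered by charts. -/
def IsClique (K : Set ℒ.B) : Prop := ∀ b ∈ K, ∀ b' ∈ K, ℒ.Adj b b'

/-- Sets contained in a chart. -/
def Good (K : Set ℒ.B) : Prop := ∃ ε, K ⊆ Set.range (ℒ.map ε)

variable {ℒ}

theorem Adj.symm {b b' : ℒ.B} (h : ℒ.Adj b b') : ℒ.Adj b' b := by
  obtain ⟨ε, x, y, hx, hy⟩ := h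
  exact ⟨ε, y, x, hy, hx⟩

theorem IsClique.mono {K K' : Set ℒ.B} (h : ℒ.IsClique K) (hK : K' ⊆ K) : ℒ.IsClique K' :=
  fun b hb b' hb' => h b (hK hb) b' (hK hb')

variable (ℒ)

/-- `l` colours the vertices of the chart `ε` which lie in `g.1` according to the equality pattern
`g.2`. -/
def Valid {q : ℕ} (ε : ℒ.E) (l : V → Option (Fin q)) (g : Set ℒ.B × Set (ℒ.B × ℒ.B)) : Prop :=
  (∀ x, l x = none ↔ ℒ.map ε x ∉ g.1) ∧
    ∀ x y, ℒ.map ε x ∈ g.1 → ℒ.map ε y ∈ g.1 → (l x = l y ↔ (ℒ.map ε x, ℒ.map ε y) ∈ g.2)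

/-- Equality patterns which can be realized by `q` colours on every chart. -/
def Pattern (q : ℕ) :=
  {g : Set ℒ.B × Set (ℒ.B × ℒ.B) // ∀ ε, ∃ l : V → Option (Fin q), ℒ.Valid ε l g}

instance (q : ℕ) : Finite (ℒ.Pattern q) := by
  have := ℒ.finite
  unfold Pattern
  infer_instance

variable {ℒ}

/-- The pattern which is mapped to a given pattern by a permutation of the level. -/
def Pattern.pull {q : ℕ} (ε₁ ε₂ : ℒ.E) (f : A.PartialAut) (g : ℒ.Pattern q) : ℒ.Pattern q :=
  ⟨({b | ℒ.Φ ε₁ ε₂ f b ∈ g.1.1}, {p | (ℒ.Φ ε₁ ε₂ f p.1, ℒ.Φ ε₁ ε₂ f p.2) ∈ g.1.2}), by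
    intro ε
    obtain ⟨ε', -, hε'⟩ := ℒ.Φ_chart ε₁ ε₂ f ε
    obtain ⟨l, hl⟩ := g.2 ε'
    refine ⟨l, fun x => ?_, fun x y hx hy => ?_⟩
    · simp only [Set.mem_ofPred_eq, hε', hl.1]
    · simp only [Set.mem_ofPred_eq, hε'] at hx hy ⊢
      exact hl.2 x y hx hy⟩

theorem Pattern.pull_coherent {q : ℕ} (ε₁ ε₂ ε₃ : ℒ.E) {f g h : A.PartialAut}
    (hc : f.IsCoherentTriple g h) (c : ℒ.Pattern q) :
    c.pull ε₁ ε₃ h = (c.pull ε₂ ε₃ g).pull ε₁ ε₂ f := by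
  apply Subtype.ext
  change (({b | ℒ.Φ ε₁ ε₃ h b ∈ c.1.1}, {p | (ℒ.Φ ε₁ ε₃ h p.1, ℒ.Φ ε₁ ε₃ h p.2) ∈ c.1.2}) :
    Set ℒ.B × Set (ℒ.B × ℒ.B)) = _
  rw [ℒ.Φ_coherent ε₁ ε₂ ε₃ f g h hc]
  rfl

theorem Pattern.pull_refl {q : ℕ} (ε : ℒ.E) {S : Set V} (hS : A.IsClosed S) (c : ℒ.Pattern q) :
    c.pull ε ε (PartialAut.refl A hS) = c := by
  apply Subtype.ext
  change (({b | ℒ.Φ ε ε (PartialAut.refl A hS) b ∈ c.1.1},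
    {p | (ℒ.Φ ε ε (PartialAut.refl A hS) p.1, ℒ.Φ ε ε (PartialAut.refl A hS) p.2) ∈ c.1.2}) :
    Set ℒ.B × Set (ℒ.B × ℒ.B)) = _
  rw [Φ_refl]
  rfl

theorem Pattern.pull_pull_symm {q : ℕ} (ε₁ ε₂ : ℒ.E) (f : A.PartialAut) (c : ℒ.Pattern q) :
    (c.pull ε₂ ε₁ f.symm).pull ε₁ ε₂ f = c := by
  rw [← Pattern.pull_coherent ε₁ ε₂ ε₁ f.symm_coherent, pull_refl]

variable (ℒ) in
/-- Labellings of a chart which realize all patterns. -/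
def PatternGen (q : ℕ) (ε : ℒ.E) (l : V → ℒ.Pattern q → Option (Fin q)) : Prop :=
  ∀ g : ℒ.Pattern q, ℒ.Valid ε (fun x => l x g) g.1

theorem exists_patternGen (q : ℕ) (ε : ℒ.E) : ∃ l, ℒ.PatternGen q ε l := by
  choose l hl using fun g : ℒ.Pattern q => g.2 ε
  exact ⟨fun x g => l g x, hl⟩

variable (ℒ) in
abbrev PatternChart (q : ℕ) :=
  {c : ℒ.E × (V → ℒ.Pattern q → Option (Fin q)) // ℒ.PatternGen q c.1 c.2}

/-- The permutation of the colours of a pattern which is used to extend a partial isomorphism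
between two labelled charts. -/
noncomputable def patternPerm {q : ℕ} (c₁ c₂ : ℒ.PatternChart q) (f : A.PartialAut)
    (g : ℒ.Pattern q) : Equiv.Perm (Option (Fin q)) :=
  extendPerm (colourGraph (fun x : f.dom => c₁.1.2 x (g.pull c₁.1.1 c₂.1.1 f))
    (fun x : f.dom => c₂.1.2 (f.toEquiv x) g))

/-- Both labellings realize their pattern, and the permutation of the level carries the pulled-back
pattern to `g`; hence equalities of colours on either side encode the same condition. -/
theorem isPartialInj_pattern {q : ℕ} (c₁ c₂ : ℒ.PatternChart q) (f : A.PartialAut)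
    (g : ℒ.Pattern q) :
    IsPartialInj (colourGraph (fun x : f.dom => c₁.1.2 x (g.pull c₁.1.1 c₂.1.1 f))
      (fun x : f.dom => c₂.1.2 (f.toEquiv x) g)) := by
  have h1 := c₁.2 (g.pull c₁.1.1 c₂.1.1 f)
  have h2 := c₂.2 g
  have hm : ∀ x : f.dom, ℒ.map c₁.1.1 x ∈ (g.pull c₁.1.1 c₂.1.1 f).1.1 ↔
      ℒ.map c₂.1.1 (f.toEquiv x) ∈ g.1.1 := by
    intro x
    rw [← ℒ.Φ_map]; rfl
  apply isPartialInj_colourGraph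
  · intro x
    rw [h1.1, h2.1, hm]
  · intro x y hx hy
    rw [Ne, h1.1, not_not] at hx hy
    rw [h1.2 x y hx hy, h2.2 _ _ ((hm x).1 hx) ((hm y).1 hy), ← ℒ.Φ_map, ← ℒ.Φ_map]
    rfl

theorem patternPerm_apply {q : ℕ} (c₁ c₂ : ℒ.PatternChart q) (f : A.PartialAut)
    (g : ℒ.Pattern q) (x : f.dom) :
    patternPerm c₁ c₂ f g (c₁.1.2 x (g.pull c₁.1.1 c₂.1.1 f)) = c₂.1.2 (f.toEquiv x) g :=
  extendPerm_apply (isPartialInj_pattern c₁ c₂ f g) (Or.inr ⟨x, rfl⟩)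

/-- The colour `none` must be fixed because it records which vertices lie outside the pattern. -/
theorem patternPerm_none {q : ℕ} (c₁ c₂ : ℒ.PatternChart q) (f : A.PartialAut)
    (g : ℒ.Pattern q) : patternPerm c₁ c₂ f g none = none :=
  extendPerm_apply (isPartialInj_pattern c₁ c₂ f g) (Or.inl rfl)

/-- After reindexing by `f.dom` the three colour maps share their middle term, and functoriality of
`extendPerm` applies. -/
theorem patternPerm_coherent {q : ℕ} (c₁ c₂ c₃ : ℒ.PatternChart q) {f f' h : A.PartialAut}
    (hc : f.IsCoherentTriple f' h) (g : ℒ.Pattern q) :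
    patternPerm c₁ c₃ h g =
      patternPerm c₂ c₃ f' g * patternPerm c₁ c₂ f (g.pull c₂.1.1 c₃.1.1 f') := by
  have i1 := isPartialInj_pattern c₁ c₂ f (g.pull c₂.1.1 c₃.1.1 f')
  have i2 := isPartialInj_pattern c₂ c₃ f' g
  let s : f.dom → f'.dom := fun x => ⟨f.toEquiv x, by rw [← hc.mid_eq]; exact (f.toEquiv x).2⟩
  have hs : Function.Surjective s := by
    rintro ⟨y, hy⟩
    have hy' : y ∈ f.cod := by rw [hc.mid_eq]; exact hy
    exact ⟨f.toEquiv.symm ⟨y, hy'⟩, by simp [s]⟩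
  let t : f.dom → h.dom := fun x => ⟨x, by rw [← hc.dom_eq]; exact x.2⟩
  have ht : Function.Surjective t := by
    rintro ⟨y, hy⟩
    exact ⟨⟨y, by rw [hc.dom_eq]; exact hy⟩, rfl⟩
  unfold patternPerm
  rw [← colourGraph_comp_surjective hs] at i2 ⊢
  rw [← colourGraph_comp_surjective ht]
  have e : ∀ x, h.toEquiv (t x) = (f'.toEquiv (s x) : V) := fun x =>
    hc.map_eq x (s x) (t x) rfl rfl
  simp only [e, Pattern.pull_coherent c₁.1.1 c₂.1.1 c₃.1.1 hc]
  exact extendPerm_colourGraph i1 i2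

/-- The labelling scheme given by the patterns with `q` colours. -/
noncomputable def patternScheme (ℒ : Level.{u₁, u₂, u₃, u₄, u₅} A) (q : ℕ) :
    Scheme.{u₁, u₂, u₃, u₄, u₅, u₄} ℒ where
  Lab := ℒ.Pattern q → Option (Fin q)
  finite := inferInstance
  Gen := ℒ.PatternGen q
  exists_gen := exists_patternGen q _
  T c₁ c₂ f := Equiv.ofBijective
    (fun p => (ℒ.Φ c₁.1.1 c₂.1.1 f p.1, fun g =>
      patternPerm c₁ c₂ f g (p.2 (g.pull c₁.1.1 c₂.1.1 f)))) (by
      have := ℒ.finite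
      refine Function.Injective.bijective_of_finite ?_
      rintro ⟨b, l⟩ ⟨b', l'⟩ h
      obtain ⟨h1, h2⟩ := Prod.ext_iff.1 h
      refine Prod.ext ((ℒ.Φ _ _ _).injective h1) (funext fun g => ?_)
      -- Every pattern is a pull-back along `f`, namely of its own pull-back along `f.symm`, so this
      -- reaches every coordinate of the label.
      have := (patternPerm _ _ _ _).injective (congrFun h2 (g.pull c₂.1.1 c₁.1.1 f.symm))
      simpa only [Pattern.pull_pull_symm] using this)
  T_map c₁ c₂ f x := Prod.ext (ℒ.Φ_map _ _ f x) (funext fun g => patternPerm_apply c₁ c₂ f g x)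
  T_chart c₁ c₂ f c := by
    obtain ⟨ε', hp, hε'⟩ := ℒ.Φ_chart c₁.1.1 c₂.1.1 f c.1.1
    refine ⟨⟨(ε', fun x g => patternPerm c₁ c₂ f g (c.1.2 x (g.pull c₁.1.1 c₂.1.1 f))), ?_⟩, hp,
      fun x => Prod.ext (hε' x) rfl⟩
    intro g
    have h1 := c.2 (g.pull c₁.1.1 c₂.1.1 f)
    have hm : ∀ x, ℒ.map c.1.1 x ∈ (g.pull c₁.1.1 c₂.1.1 f).1.1 ↔ ℒ.map ε' x ∈ g.1.1 := by
      intro x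
      rw [← hε']; rfl
    constructor
    · intro x
      have := h1.1 x
      rw [hm] at this
      rw [← this]
      nth_rw 1 [← patternPerm_none c₁ c₂ f g]
      exact (patternPerm c₁ c₂ f g).injective.eq_iff
    · intro x y hx hy
      refine (patternPerm c₁ c₂ f g).injective.eq_iff.trans ?_
      rw [h1.2 x y ((hm x).2 hx) ((hm y).2 hy), ← hε', ← hε']
      rfl
  T_coherent c₁ c₂ c₃ f f' h hc := by
    ext1 p
    refine Prod.ext ?_ (funext fun g => ?_)
    · change ℒ.Φ _ _ h p.1 = _
      rw [ℒ.Φ_coherent _ c₂.1.1 _ f f' h hc]; rfl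
    · change patternPerm c₁ c₃ h g (p.2 (g.pull c₁.1.1 c₃.1.1 h)) = _
      rw [patternPerm_coherent c₁ c₂ c₃ hc, Pattern.pull_coherent c₁.1.1 c₂.1.1 c₃.1.1 hc]
      rfl

/-- The level given by the patterns with `q` colours. -/
noncomputable abbrev next (ℒ : Level.{u₁, u₂, u₃, u₄, u₅} A) (q : ℕ) : Level A :=
  (ℒ.patternScheme q).step

/-- The projection from the level given by the patterns with `q` colours. -/
noncomputable abbrev nextProj {q : ℕ} (b : (ℒ.next q).B) : ℒ.B := (ℒ.patternScheme q).proj b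

/-- The colour of a vertex with respect to a pattern. -/
noncomputable def colour {q : ℕ} (g : ℒ.Pattern q) (b : (ℒ.next q).B) : Option (Fin q) := b.1.2 g

theorem colour_eq_none_iff {q : ℕ} (g : ℒ.Pattern q) {b : (ℒ.next q).B} (hb : (ℒ.next q).Adj b b) :
    colour g b = none ↔ nextProj b ∉ g.1.1 := by
  obtain ⟨c, x, -, rfl, -⟩ := hb
  exact (c.2 g).1 x

theorem colour_eq_iff {q : ℕ} (g : ℒ.Pattern q) {b b' : (ℒ.next q).B}
    (hb : (ℒ.next q).Adj b b') (h : nextProj b ∈ g.1.1) (h' : nextProj b' ∈ g.1.1) :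
    colour g b = colour g b' ↔ (nextProj b, nextProj b') ∈ g.1.2 := by
  obtain ⟨c, x, y, rfl, rfl⟩ := hb
  exact (c.2 g).2 x y h h'

theorem Adj.proj {q : ℕ} {b b' : (ℒ.next q).B} (h : (ℒ.next q).Adj b b') :
    ℒ.Adj (nextProj b) (nextProj b') := by
  obtain ⟨c, x, y, rfl, rfl⟩ := h
  exact ⟨c.1.1, x, y, rfl, rfl⟩

theorem Adj.eq_of_proj_eq {q : ℕ} {b b' : (ℒ.next q).B} (h : (ℒ.next q).Adj b b')
    (hbb : nextProj b = nextProj b') : b = b' := by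
  obtain ⟨c, x, y, rfl, rfl⟩ := h
  rw [ℒ.injective c.1.1 hbb]

theorem IsClique.image_proj {q : ℕ} {K : Set (ℒ.next q).B} (h : (ℒ.next q).IsClique K) :
    ℒ.IsClique (nextProj '' K) := by
  rintro _ ⟨b, hb, rfl⟩ _ ⟨b', hb', rfl⟩
  exact (h b hb b' hb').proj

theorem IsClique.injOn_proj {q : ℕ} {K : Set (ℒ.next q).B} (h : (ℒ.next q).IsClique K) :
    Set.InjOn (nextProj (ℒ := ℒ) (q := q)) K :=
  fun b hb b' hb' => (h b hb b' hb').eq_of_proj_eq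

/-- Cliques which project to good sets are good. -/
theorem IsClique.good_of_good_image {q : ℕ} (hℒ : ℒ.Compat) {K : Set (ℒ.next q).B}
    (hK : (ℒ.next q).IsClique K) (h : ℒ.Good (nextProj '' K)) : (ℒ.next q).Good K := by
  obtain ⟨ε, hε⟩ := h
  -- The labels that the members of `K`, through their generated substructures, demand on the chart
  -- `ε`. Any two demands come from one labelled chart since `K` is a clique, so for each pattern
  -- they define a partial injection of colours from any reference labelling `l₀`. Permuting the
  -- colours of `l₀` accordingly meets all demands.
  let ρ : Set (V × (ℒ.Pattern q → Option (Fin q))) := {p | ∃ b ∈ K, (ℒ.map ε p.1, p.2) ∈ b.2}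
  have hρ : ∀ p ∈ ρ, ∀ p' ∈ ρ, ∃ (c : ℒ.PatternChart q) (w w' : V), ℒ.map c.1.1 w = ℒ.map ε p.1 ∧
      c.1.2 w = p.2 ∧ ℒ.map c.1.1 w' = ℒ.map ε p'.1 ∧ c.1.2 w' = p'.2 := by
    rintro p ⟨b, hb, hp⟩ p' ⟨b', hb', hp'⟩
    obtain ⟨c, x, y, rfl, rfl⟩ := hK b hb b' hb'
    obtain ⟨w, -, hw⟩ := hp
    obtain ⟨w', -, hw'⟩ := hp'
    exact ⟨c, w, w', congrArg Prod.fst hw, congrArg Prod.snd hw, congrArg Prod.fst hw',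
      congrArg Prod.snd hw'⟩
  obtain ⟨l₀, hl₀⟩ := exists_patternGen q ε
  have hPI : ∀ g : ℒ.Pattern q, IsPartialInj
      (colourGraph (fun p : ρ => l₀ p.1.1 g) (fun p : ρ => p.1.2 g)) := by
    intro g
    apply isPartialInj_colourGraph
    · intro p
      obtain ⟨c, w, -, h1, h2, -⟩ := hρ p p.2 p p.2
      rw [(hl₀ g).1, ← h1, ← h2, (c.2 g).1]
    · intro p p' hp hp'
      obtain ⟨c, w, w', h1, h2, h3, h4⟩ := hρ p p.2 p' p'.2
      rw [Ne, (hl₀ g).1, not_not] at hp hp'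
      rw [(hl₀ g).2 _ _ hp hp', ← h2, ← h4, (c.2 g).2 w w' (by rwa [h1]) (by rwa [h3]), h1, h3]
  let l : V → ℒ.Pattern q → Option (Fin q) := fun x g => extendPerm
    (colourGraph (fun p : ρ => l₀ p.1.1 g) (fun p : ρ => p.1.2 g)) (l₀ x g)
  have hl : ∀ p ∈ ρ, l p.1 = p.2 := fun p hp => funext fun g =>
    extendPerm_apply (hPI g) (Or.inr ⟨⟨p, hp⟩, rfl⟩)
  have hgen : ℒ.PatternGen q ε l := by
    intro g
    refine ⟨fun x => ?_, fun x y hx hy => ?_⟩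
    · rw [← (hl₀ g).1]
      have h0 := extendPerm_apply (hPI g) (Or.inl rfl)
      constructor
      · intro h
        exact (Equiv.injective _) (h.trans h0.symm)
      · intro h
        simp only [l, h, h0]
    · rw [← (hl₀ g).2 x y hx hy]
      exact (Equiv.injective _).eq_iff
  refine ⟨⟨(ε, l), hgen⟩, fun b hb => ?_⟩
  obtain ⟨x, hx⟩ := hε ⟨b, hb, rfl⟩
  refine ⟨x, ?_⟩
  obtain ⟨c, y, -, hy, -⟩ := hK b hb b hb
  have hxy : ℒ.map ε x = ℒ.map c.1.1 y := by rw [hx, ← hy]; rfl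
  have key : ∀ z, ∀ w ∈ A.cl y, ℒ.map ε z = ℒ.map c.1.1 w →
      (ℒ.map ε z, l z) = (ℒ.map c.1.1 w, c.1.2 w) := by
    intro z w hw hzw
    refine Prod.ext hzw ?_
    refine hl (z, c.1.2 w) ⟨b, hb, ?_⟩
    rw [← hy]
    exact ⟨w, hw, Prod.ext hzw.symm rfl⟩
  rw [← hy]
  refine Prod.ext (key x y (A.mem_cl_self y) hxy) (Set.Subset.antisymm ?_ ?_)
  · rintro _ ⟨z, hz, rfl⟩
    obtain ⟨w, hw, hzw⟩ := hℒ.exists_mem_cl hxy hz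
    exact ⟨w, hw, (key z w hw hzw).symm⟩
  · rintro _ ⟨w, hw, rfl⟩
    obtain ⟨z, hz, hzw⟩ := hℒ.exists_mem_cl hxy.symm hw
    exact ⟨z, hz, key z w hw hzw.symm⟩

/-- Cliques with `q + 1` vertices are good in the level given by the patterns with `q` colours. -/
theorem IsClique.good_of_ncard {q : ℕ} (hℒ : ℒ.Compat) {K : Set (ℒ.next q).B}
    (hK : (ℒ.next q).IsClique K) (hq : K.ncard = q + 1) : (ℒ.next q).Good K := by
  classical
  have := ℒ.finite
  have := (ℒ.next q).finite
  refine hK.good_of_good_image hℒ ?_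
  by_contra hbad
  have hcard : (nextProj '' K).ncard = q + 1 := by rw [hK.injOn_proj.ncard_image, hq]
  -- No chart contains the projected set, so each meets it in at most `q` points and can give them
  -- distinct colours. On the clique `K` itself all `q + 1` colours would be distinct.
  have hpat : ∀ ε, ∃ l : V → Option (Fin q),
      ℒ.Valid ε l (nextProj '' K, {p | p.1 = p.2}) := by
    intro ε
    have hlt : ((nextProj '' K) ∩ Set.range (ℒ.map ε)).ncard < q + 1 := by
      rw [← hcard]
      refine Set.ncard_lt_ncard ⟨Set.inter_subset_left, fun h => hbad ⟨ε, fun b hb => (h hb).2⟩⟩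
    obtain ⟨e⟩ : Nonempty (((nextProj '' K) ∩ Set.range (ℒ.map ε) : Set ℒ.B) ↪ Fin q) := by
      have := Fintype.ofFinite ((nextProj '' K) ∩ Set.range (ℒ.map ε) : Set ℒ.B)
      refine Function.Embedding.nonempty_of_card_le ?_
      rw [Fintype.card_fin, ← Nat.card_eq_fintype_card, Nat.card_coe_set_eq]
      omega
    refine ⟨fun x => if h : ℒ.map ε x ∈ nextProj '' K then some (e ⟨ℒ.map ε x, h, x, rfl⟩)
      else none, fun x => ?_, fun x y hx hy => ?_⟩
    · by_cases h : ℒ.map ε x ∈ nextProj '' K <;> simp only [h, dite_true, dite_false] <;> simp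
    · simp only [hx, hy, dite_true, Option.some_inj, e.injective.eq_iff, Set.mem_ofPred_eq]
      exact Subtype.mk_eq_mk
  let g : ℒ.Pattern q := ⟨_, hpat⟩
  have hinj : Set.InjOn (colour g) K := by
    intro b hb b' hb' h
    exact hK.injOn_proj hb hb' ((colour_eq_iff g (hK b hb b' hb') ⟨b, hb, rfl⟩ ⟨b', hb', rfl⟩).1 h)
  have hsub : colour g '' K ⊆ {none}ᶜ := by
    rintro _ ⟨b, hb, rfl⟩
    rw [Set.mem_compl_singleton_iff, Ne, colour_eq_none_iff g (hK b hb b hb), not_not]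
    exact ⟨b, hb, rfl⟩
  have h1 := Set.ncard_le_ncard hsub
  rw [hinj.ncard_image, hq, Set.ncard_compl, Set.ncard_singleton,
    Nat.card_eq_fintype_card, Fintype.card_option, Fintype.card_fin] at h1
  omega

end Level

end EPPA

/-! ### Separating cliques from a parity obstruction -/

namespace EPPA

open Str

universe u₁ u₂ u₃ u₄ u₅ u₆

section Separation

variable {α : Type*}

/-- There are no edges between the disjoint sets `P` of `u` and `Q` of `v`. -/
structure Separates (R : α → α → Prop) (C : Set α) (u v : α) (P Q : Set α) : Prop where
  left_mem : u ∈ P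
  right_mem : v ∈ Q
  left_subset : P ⊆ C
  right_subset : Q ⊆ C
  disjoint : ∀ p ∈ P, p ∉ Q
  not_adj : ∀ p ∈ P, ∀ q ∈ Q, ¬ R p q

theorem Separates.symm {R : α → α → Prop} (hR : ∀ a b, R a b → R b a) {C : Set α} {u v : α}
    {P Q : Set α} (h : Separates R C u v P Q) : Separates R C v u Q P where
  left_mem := h.right_mem
  right_mem := h.left_mem
  left_subset := h.right_subset
  right_subset := h.left_subset
  disjoint q hq hp := h.disjoint q hp hq
  not_adj q hq p hp hqp := h.not_adj p hp q hq (hR _ _ hqp)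

/-- In a maximal separation, each separating vertex has a neighbour in each union of components
that contains `u`. -/
theorem Separates.exists_adj [Finite α] {R : α → α → Prop} (hR : ∀ a b, R a b → R b a) {C : Set α}
    {u v : α} {P Q : Set α} (h : Separates R C u v P Q)
    (hmax : ∀ P' Q', Separates R C u v P' Q' → (P' ∪ Q').ncard ≤ (P ∪ Q).ncard)
    {β : Type*} (κ : α → β) (hκ : ∀ a ∈ P, ∀ b ∈ P, R a b → κ a = κ b) {r : α} (hr : r ∈ C)
    (hrP : r ∉ P) (hrQ : r ∉ Q) : ∃ p ∈ P, κ p = κ u ∧ R r p := by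
  by_contra! hno
  -- Without such a neighbour, `r` and the part of `P` with other values of `κ` can be moved to the
  -- side of `v`; the new separation covers one more vertex.
  have hsep : Separates R C u v {p ∈ P | κ p = κ u} (insert r (Q ∪ {p ∈ P | κ p ≠ κ u})) := by
    refine ⟨⟨h.left_mem, rfl⟩, Or.inr (Or.inl h.right_mem), fun p hp => h.left_subset hp.1, ?_,
      ?_, ?_⟩
    · rintro q (rfl | hq | hq)
      exacts [hr, h.right_subset hq, h.left_subset hq.1]
    · rintro p ⟨hp, hpu⟩ (rfl | hq | hq)
      exacts [hrP hp, h.disjoint p hp hq, hq.2 hpu]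
    · rintro p ⟨hp, hpu⟩ q (rfl | hq | hq) hpq
      · exact hno p hp hpu (hR _ _ hpq)
      · exact h.not_adj p hp q hq hpq
      · exact hq.2 ((hκ p hp q hq.1 hpq).symm.trans hpu)
  have h1 := hmax _ _ hsep
  have h2 : insert r (P ∪ Q) ⊆ {p ∈ P | κ p = κ u} ∪ insert r (Q ∪ {p ∈ P | κ p ≠ κ u}) := by
    rintro a (rfl | ha | ha)
    · exact Or.inr (Or.inl rfl)
    · by_cases hau : κ a = κ u
      · exact Or.inl ⟨ha, hau⟩
      · exact Or.inr (Or.inr (Or.inr ⟨ha, hau⟩))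
    · exact Or.inr (Or.inr (Or.inl ha))
  have h3 := Set.ncard_le_ncard h2
  rw [Set.ncard_insert_of_notMem (fun h => h.elim hrP hrQ)] at h3
  omega

theorem exists_maximal_separates [Finite α] {R : α → α → Prop} {C : Set α} {u v : α} (hu : u ∈ C)
    (hv : v ∈ C) (huv : u ≠ v) (hR : ¬ R u v) : ∃ P Q, Separates R C u v P Q ∧
      ∀ P' Q', Separates R C u v P' Q' → (P' ∪ Q').ncard ≤ (P ∪ Q).ncard := by
  obtain ⟨p, hp, hmax⟩ := Set.exists_max_image {p : Set α × Set α | Separates R C u v p.1 p.2}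
    (fun p => (p.1 ∪ p.2).ncard) (Set.toFinite _) ⟨({u}, {v}), rfl, rfl, by simpa using hu,
      by simpa using hv, by simpa using huv, by simpa using hR⟩
  exact ⟨p.1, p.2, hp, fun P' Q' h => hmax (P', Q') h⟩

end Separation

variable {L : PermLanguage.{u₁, u₂}} {V : Type u₃} {A : Str L V}

namespace Level

variable {ℒ : Level.{u₁, u₂, u₃, u₄, u₅} A}

/-- If the projection to the previous level is injective on `C` and reflects adjacency, then `C` is
a clique or has a separating clique. -/
theorem exists_separating_clique {C : Set (ℒ.next 2).B} (hcov : ∀ b ∈ C, (ℒ.next 2).Adj b b)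
    (hinj : Set.InjOn (nextProj (ℒ := ℒ) (q := 2)) C)
    (hadj : ∀ b ∈ C, ∀ b' ∈ C, ℒ.Adj (nextProj b) (nextProj b') → (ℒ.next 2).Adj b b')
    (hC : ¬ (ℒ.next 2).IsClique C) : ∃ C₁ C₂ : Set (ℒ.next 2).B, C₁ ⊂ C ∧ C₂ ⊂ C ∧ C₁ ∪ C₂ = C ∧
      (ℒ.next 2).IsClique (C₁ ∩ C₂) ∧ ∀ b ∈ C₁ \ C₂, ∀ b' ∈ C₂ \ C₁, ¬ (ℒ.next 2).Adj b b' := by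
  classical
  have := (ℒ.next 2).finite
  unfold IsClique at hC
  push Not at hC
  obtain ⟨u, hu, v, hv, huv⟩ := hC
  have hne : u ≠ v := by rintro rfl; exact huv (hcov u hu)
  have hsymm : ∀ b b', (ℒ.next 2).Adj b b' → (ℒ.next 2).Adj b' b := fun _ _ h => h.symm
  obtain ⟨P, Q, hsep, hmax⟩ := exists_maximal_separates hu hv hne huv
  refine ⟨C \ Q, C \ P, ⟨Set.sdiff_subset, fun h => (h hv).2 hsep.right_mem⟩,
    ⟨Set.sdiff_subset, fun h => (h hu).2 hsep.left_mem⟩, ?_, ?_, ?_⟩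
  · ext b
    constructor
    · rintro (h | h) <;> exact h.1
    · intro hb
      by_cases hQ : b ∈ Q
      · exact Or.inr ⟨hb, fun hP => hsep.disjoint b hP hQ⟩
      · exact Or.inl ⟨hb, hQ⟩
  · rintro s ⟨⟨hs, hsQ⟩, -, hsP⟩ t ⟨⟨ht, htQ⟩, -, htP⟩
    by_contra hst
    -- Suppose `s` and `t` in the separator are not adjacent. By maximality both have neighbours on
    -- each side, which closes up to cycles through `P`, `s`, `Q`, `t`. The pattern demands a change
    -- of colour exactly on the edges between `s` and `Q`.
    let c : Set (ℒ.next 2).B := insert s (insert t (P ∪ Q))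
    have hcC : c ⊆ C := by
      rintro b (rfl | rfl | hb | hb)
      exacts [hs, ht, hsep.left_subset hb, hsep.right_subset hb]
    have hpat : ∀ ε, ∃ l : V → Option (Fin 2), ℒ.Valid ε l (nextProj '' c,
        {p | ¬ ((p.1 = nextProj s ∧ p.2 ∈ nextProj '' Q) ∨
          (p.1 ∈ nextProj '' Q ∧ p.2 = nextProj s))}) := by
      intro ε
      -- On a chart containing `s`, colour `Q` by `1` and everything else in `c` by `0`. If the
      -- chart also meets `Q`, it contains neither `t` nor a point of `P`, as adjacency is
      -- reflected, so only `s` gets the other colour. A chart missing `s` is coloured constantly.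
      refine ⟨fun x => if ℒ.map ε x ∈ nextProj '' c then
        some (if (∃ y, ℒ.map ε y = nextProj s) ∧ ℒ.map ε x ∈ nextProj '' Q then 1 else 0) else none,
        fun x => ?_, fun x y hx hy => ?_⟩
      · by_cases h : ℒ.map ε x ∈ nextProj '' c <;> simp only [h, if_true, if_false] <;> simp
      · simp only [hx, hy, if_true, Option.some_inj]
        obtain ⟨b, hb, hbx⟩ := hx
        obtain ⟨b', hb', hby⟩ := hy
        have hbs : nextProj b = nextProj s ↔ b = s := hinj.eq_iff (hcC hb) hs
        have hbs' : nextProj b' = nextProj s ↔ b' = s := hinj.eq_iff (hcC hb') hs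
        have hbQ : nextProj b ∈ nextProj '' Q ↔ b ∈ Q :=
          hinj.mem_image_iff hsep.right_subset (hcC hb)
        have hbQ' : nextProj b' ∈ nextProj '' Q ↔ b' ∈ Q :=
          hinj.mem_image_iff hsep.right_subset (hcC hb')
        rw [Set.mem_ofPred_eq]
        simp only [← hbx, ← hby, hbs, hbs', hbQ, hbQ']
        by_cases hch : ∃ y, ℒ.map ε y = nextProj s
        · have had : ∀ b₁ ∈ c, ∀ b₂ ∈ c, ∀ x y, nextProj b₁ = ℒ.map ε x → nextProj b₂ = ℒ.map ε y →
              (ℒ.next 2).Adj b₁ b₂ := fun b₁ h₁ b₂ h₂ x y hx hy =>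
            hadj b₁ (hcC h₁) b₂ (hcC h₂) ⟨ε, x, y, hx.symm, hy.symm⟩
          have key : ∀ b₁ ∈ c, ∀ b₂ ∈ c, ∀ x y, nextProj b₁ = ℒ.map ε x →
              nextProj b₂ = ℒ.map ε y → b₁ ∈ Q → b₂ ∉ Q → b₂ = s := by
            intro b₁ h₁ b₂ h₂ x y hx hy h1 h2
            obtain ⟨z, hz⟩ := hch
            rcases h₂ with rfl | rfl | h₂ | h₂
            · rfl
            · exact absurd (had s (Or.inl rfl) _ (Or.inr (Or.inl rfl)) z y hz.symm hy) hst
            · exact absurd (had b₂ (Or.inr (Or.inr (Or.inl h₂))) b₁ h₁ y x hy hx)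
                (hsep.not_adj b₂ h₂ b₁ h1)
            · exact absurd h₂ h2
          by_cases h1 : b ∈ Q <;> by_cases h2 : b' ∈ Q
          · have e1 : b ≠ s := by rintro rfl; exact hsQ h1
            have e2 : b' ≠ s := by rintro rfl; exact hsQ h2
            simp [h1, h2, e1, e2]
          · have := key b hb b' hb' x y hbx hby h1 h2
            simp [hch, h1, this, hsQ]
          · have := key b' hb' b hb y x hby hbx h2 h1
            simp [hch, h2, this, hsQ]
          · simp [h1, h2]
        · have e1 : b ≠ s := by rintro rfl; exact hch ⟨x, hbx.symm⟩
          have e2 : b' ≠ s := by rintro rfl; exact hch ⟨y, hby.symm⟩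
          simp [hch, e1, e2]
    let g : ℒ.Pattern 2 := ⟨_, hpat⟩
    have hcol : ∀ b ∈ c, ∀ b' ∈ c, (ℒ.next 2).Adj b b' →
        (colour g b = colour g b' ↔ ¬ ((b = s ∧ b' ∈ Q) ∨ (b ∈ Q ∧ b' = s))) := by
      intro b hb b' hb' hbb
      refine (colour_eq_iff g hbb ⟨b, hb, rfl⟩ ⟨b', hb', rfl⟩).trans ?_
      have hbs : nextProj b = nextProj s ↔ b = s := hinj.eq_iff (hcC hb) hs
      have hbs' : nextProj b' = nextProj s ↔ b' = s := hinj.eq_iff (hcC hb') hs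
      have hbQ : nextProj b ∈ nextProj '' Q ↔ b ∈ Q :=
        hinj.mem_image_iff hsep.right_subset (hcC hb)
      have hbQ' : nextProj b' ∈ nextProj '' Q ↔ b' ∈ Q :=
        hinj.mem_image_iff hsep.right_subset (hcC hb')
      rw [← hbs, ← hbs', ← hbQ, ← hbQ']
      rfl
    have hPc : P ⊆ c := fun b hb => Or.inr (Or.inr (Or.inl hb))
    have hQc : Q ⊆ c := fun b hb => Or.inr (Or.inr (Or.inr hb))
    have hsc : s ∈ c := Or.inl rfl
    have htc : t ∈ c := Or.inr (Or.inl rfl)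
    have hts : t ≠ s := by rintro rfl; exact hst (hcov t ht)
    have hκP : ∀ a ∈ P, ∀ b ∈ P, (ℒ.next 2).Adj a b → colour g a = colour g b := by
      intro a ha b hb hab
      rw [hcol a (hPc ha) b (hPc hb) hab]
      rintro (⟨rfl, -⟩ | ⟨-, rfl⟩)
      exacts [hsP ha, hsP hb]
    have hκQ : ∀ a ∈ Q, ∀ b ∈ Q, (ℒ.next 2).Adj a b → colour g a = colour g b := by
      intro a ha b hb hab
      rw [hcol a (hQc ha) b (hQc hb) hab]
      rintro (⟨rfl, -⟩ | ⟨-, rfl⟩)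
      exacts [hsQ ha, hsQ hb]
    have hmax' : ∀ P' Q', Separates (ℒ.next 2).Adj C v u P' Q' →
        (P' ∪ Q').ncard ≤ (Q ∪ P).ncard := fun P' Q' h => by
      rw [Set.union_comm Q, Set.union_comm P']
      exact hmax _ _ (h.symm hsymm)
    obtain ⟨p₁, hp₁, hpu₁, hsp⟩ := hsep.exists_adj hsymm hmax _ hκP hs hsP hsQ
    obtain ⟨p₂, hp₂, hpu₂, htp⟩ := hsep.exists_adj hsymm hmax _ hκP ht htP htQ
    obtain ⟨q₁, hq₁, hqv₁, hsq⟩ := (hsep.symm hsymm).exists_adj hsymm hmax' _ hκQ hs hsQ hsP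
    obtain ⟨q₂, hq₂, hqv₂, htq⟩ := (hsep.symm hsymm).exists_adj hsymm hmax' _ hκQ ht htQ htP
    have e1 : colour g s = colour g p₁ := by
      rw [hcol s hsc p₁ (hPc hp₁) hsp]
      rintro (⟨-, h⟩ | ⟨h, -⟩)
      exacts [hsep.disjoint _ hp₁ h, hsQ h]
    have e2 : colour g t = colour g p₂ := by
      rw [hcol t htc p₂ (hPc hp₂) htp]
      rintro (⟨h, -⟩ | ⟨h, -⟩)
      exacts [hts h, htQ h]
    have e3 : colour g s ≠ colour g q₁ := by
      rw [Ne, hcol s hsc q₁ (hQc hq₁) hsq, not_not]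
      exact Or.inl ⟨rfl, hq₁⟩
    have e4 : colour g t = colour g q₂ := by
      rw [hcol t htc q₂ (hQc hq₂) htq]
      rintro (⟨h, -⟩ | ⟨h, -⟩)
      exacts [hts h, htQ h]
    -- Going from `s` through `P` to `t` and back through `Q`, the colour would change only on the
    -- last edge into `s`.
    exact e3 (by rw [e1, hpu₁, ← hpu₂, ← e2, e4, hqv₂, hqv₁])
  · rintro b ⟨⟨hb, hbQ⟩, hbP⟩ b' ⟨⟨hb', hbP'⟩, hbQ'⟩
    have h1 : b ∈ P := by by_contra h; exact hbP ⟨hb, h⟩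
    have h2 : b' ∈ Q := by by_contra h; exact hbQ' ⟨hb', h⟩
    exact hsep.not_adj b h1 b' h2

end Level

end EPPA

/-! ### Mapping small sets of vertices to `M` -/

namespace EPPA

open Str

universe u₁ u₂ u₃ u₄ u₅ u₆

variable {L : PermLanguage.{u₁, u₂}} {V : Type u₃} {A : Str L V} {X : Type u₆} {M : Str L X}

namespace Str

/-- The composition of two automorphisms. -/
def Aut.comp (a b : M.Aut) : M.Aut where
  perm := a.perm * b.perm
  toEquiv := b.toEquiv.trans a.toEquiv
  isEmbedding := a.isEmbedding.comp b.isEmbedding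

/-- The inverse of an automorphism. -/
def Aut.symm (a : M.Aut) : M.Aut where
  perm := a.perm⁻¹
  toEquiv := a.toEquiv.symm
  isEmbedding := a.isEmbedding.symm

/-- The empty partial automorphism with a given language part. -/
def PartialAut.empty (A : Str L V) (g : L.Γ) : A.PartialAut where
  perm := g
  dom := ∅
  cod := ∅
  dom_closed := fun _ _ h => h.elim
  cod_closed := fun _ _ h => h.elim
  toEquiv := Equiv.refl _
  isEmbedding := ⟨Function.injective_id, fun {n} _ x => (x ⟨0, n.2⟩).2.elim, fun _ x => x.2.elim⟩

end Str

namespace Level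

variable (ℒ : Level.{u₁, u₂, u₃, u₄, u₅} A)

/-- There is a map from `C` to `M` which agrees on each chart with an automorphism of `M`. -/
def Real (j : A.Emb M) (C : Set ℒ.B) : Prop :=
  ∃ m : C → X, ∀ ε, ∃ θ : M.Aut, θ.perm = ℒ.perm ε ∧
    ∀ x (h : ℒ.map ε x ∈ C), m ⟨ℒ.map ε x, h⟩ = θ.toEquiv (j.toFun x)

variable {ℒ} {j : A.Emb M}

/-- Map `C` through one chart containing it. The overlap with any other chart is a partial
automorphism of `A`, whose extension to `M` supplies the automorphism required for that chart. -/
theorem Good.real (hℒ : ℒ.Compat) (hj : j.perm = 1)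
    (hext : ∀ f : A.PartialAut, ∃ e : M.Aut, e.Extends j f) {C : Set ℒ.B} (hC : ℒ.Good C) :
    ℒ.Real j C := by
  obtain ⟨ε₀, hε₀⟩ := hC
  choose a ha using fun b : C => hε₀ b.2
  -- Extending the empty partial automorphism yields an automorphism of `M` with the prescribed
  -- language part.
  obtain ⟨θ₀, hθ₀, -⟩ := hext (PartialAut.empty A (ℒ.perm ε₀))
  have hp : θ₀.perm = ℒ.perm ε₀ := by simpa [hj, PartialAut.empty] using hθ₀
  refine ⟨fun b => θ₀.toEquiv (j.toFun (a b)), fun ε => ?_⟩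
  obtain ⟨f, hf, hdom, hmap⟩ := hℒ.exists_overlap ε ε₀
  obtain ⟨θ, hθ, hθf⟩ := hext f
  refine ⟨θ₀.comp θ, ?_, fun x hx => ?_⟩
  · simp [Aut.comp, hp, hθ, hj, hf]
  · have hx' : x ∈ f.dom := hdom x _ (ha ⟨_, hx⟩).symm
    have h1 : a ⟨_, hx⟩ = f.toEquiv ⟨x, hx'⟩ :=
      ℒ.injective ε₀ ((ha ⟨_, hx⟩).trans (hmap ⟨x, hx'⟩))
    change θ₀.toEquiv (j.toFun (a ⟨_, hx⟩)) = θ₀.toEquiv (θ.toEquiv (j.toFun x))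
    rw [h1, ← hθf ⟨x, hx'⟩]

/-- On the intersection, which lies in one chart, the two maps differ by an automorphism `σ` of `M`
with trivial language part; correct the second map by `σ`. By `hadj` no chart meets both
differences, so its trace on the union lies in one of the two sets. -/
theorem Real.union {C₁ C₂ : Set ℒ.B} (h₁ : ℒ.Real j C₁) (h₂ : ℒ.Real j C₂)
    (hgood : ℒ.Good (C₁ ∩ C₂)) (hadj : ∀ b ∈ C₁ \ C₂, ∀ b' ∈ C₂ \ C₁, ¬ ℒ.Adj b b') :
    ℒ.Real j (C₁ ∪ C₂) := by
  classical
  obtain ⟨m₁, h₁⟩ := h₁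
  obtain ⟨m₂, h₂⟩ := h₂
  obtain ⟨ε₀, hε₀⟩ := hgood
  obtain ⟨θ₁, hp₁, hm₁⟩ := h₁ ε₀
  obtain ⟨θ₂, hp₂, hm₂⟩ := h₂ ε₀
  let σ := θ₁.comp θ₂.symm
  have hσ : σ.perm = 1 := by simp [σ, Aut.comp, Aut.symm, hp₁, hp₂]
  have hσm : ∀ b (hb₁ : b ∈ C₁) (hb₂ : b ∈ C₂), m₁ ⟨b, hb₁⟩ = σ.toEquiv (m₂ ⟨b, hb₂⟩) := by
    intro b hb₁ hb₂
    obtain ⟨x, rfl⟩ := hε₀ ⟨hb₁, hb₂⟩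
    rw [hm₁, hm₂]
    simp [σ, Aut.comp, Aut.symm]
  refine ⟨fun b => if h : (b : ℒ.B) ∈ C₁ then m₁ ⟨b, h⟩ else
    σ.toEquiv (m₂ ⟨b, ((Set.mem_union _ _ _).1 b.2).resolve_left h⟩), fun ε => ?_⟩
  by_cases hε : ∃ x, ℒ.map ε x ∈ C₂ \ C₁
  · obtain ⟨y, hy⟩ := hε
    obtain ⟨θ, hp, hm⟩ := h₂ ε
    refine ⟨σ.comp θ, by simp [Aut.comp, hσ, hp], fun x hx => ?_⟩
    have hx2 : ℒ.map ε x ∈ C₂ := by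
      by_contra h
      exact hadj _ ⟨hx.resolve_right h, h⟩ _ hy ⟨ε, x, y, rfl, rfl⟩
    have : (σ.comp θ).toEquiv (j.toFun x) = σ.toEquiv (m₂ ⟨_, hx2⟩) := by rw [hm]; rfl
    rw [this]
    beta_reduce
    split_ifs with h
    · exact hσm _ h hx2
    · rfl
  · push Not at hε
    obtain ⟨θ, hp, hm⟩ := h₁ ε
    refine ⟨θ, hp, fun x hx => ?_⟩
    have hx1 : ℒ.map ε x ∈ C₁ := by
      by_contra h
      exact hε x ⟨hx.resolve_left h, h⟩
    beta_reduce
    rw [dif_pos hx1, hm]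

/-- Charts project to charts with the same language part and nothing is asked of the map across
charts, so composing with the projection suffices. -/
theorem Real.of_image_proj {q : ℕ} {C : Set (ℒ.next q).B} (h : ℒ.Real j (nextProj '' C)) :
    (ℒ.next q).Real j C := by
  obtain ⟨m, hm⟩ := h
  refine ⟨fun b => m ⟨nextProj b.1, b.1, b.2, rfl⟩, fun c => ?_⟩
  obtain ⟨θ, hp, hθ⟩ := hm c.1.1
  exact ⟨θ, hp, fun x h => hθ x _⟩

theorem compat_next (hℒ : ℒ.Compat) (q : ℕ) : (ℒ.next q).Compat :=
  Scheme.compat_step_of_compat _ hℒ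

theorem isClique_good_next (hℒ : ℒ.Compat) (hgood : ∀ K, ℒ.IsClique K → ℒ.Good K) (q : ℕ)
    (K : Set (ℒ.next q).B) (hK : (ℒ.next q).IsClique K) : (ℒ.next q).Good K :=
  hK.good_of_good_image hℒ (hgood _ hK.image_proj)

/-- Sets on which the projection is injective and reflects adjacency can be mapped to `M`. -/
theorem real_of_injOn (hℒ : ℒ.Compat) (hgood : ∀ K, ℒ.IsClique K → ℒ.Good K) (hj : j.perm = 1)
    (hext : ∀ f : A.PartialAut, ∃ e : M.Aut, e.Extends j f) {C : Set (ℒ.next 2).B}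
    (hcov : ∀ b ∈ C, (ℒ.next 2).Adj b b)
    (hinj : Set.InjOn (nextProj (ℒ := ℒ) (q := 2)) C)
    (hadj : ∀ b ∈ C, ∀ b' ∈ C, ℒ.Adj (nextProj b) (nextProj b') → (ℒ.next 2).Adj b b') :
    (ℒ.next 2).Real j C := by
  have := (ℒ.next 2).finite
  induction hn : C.ncard using Nat.strong_induction_on generalizing C with
  | _ n ih =>
    by_cases hC : (ℒ.next 2).IsClique C
    · exact (isClique_good_next hℒ hgood 2 C hC).real (compat_next hℒ 2) hj hext
    · obtain ⟨C₁, C₂, h₁, h₂, rfl, hK, hno⟩ := exists_separating_clique hcov hinj hadj hC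
      subst hn
      have key : ∀ C' ⊂ C₁ ∪ C₂, (ℒ.next 2).Real j C' := fun C' h =>
        ih _ (Set.ncard_lt_ncard h) (fun b hb => hcov b (h.1 hb)) (hinj.mono h.1)
          (fun b hb b' hb' => hadj b (h.1 hb) b' (h.1 hb')) rfl
      exact (key _ h₁).union (key _ h₂) (isClique_good_next hℒ hgood 2 _ hK) hno

/-- The pairs of adjacent vertices of `C`. -/
def edges (ℒ : Level.{u₁, u₂, u₃, u₄, u₅} A) (C : Set ℒ.B) : Set (ℒ.B × ℒ.B) :=
  {p | p.1 ∈ C ∧ p.2 ∈ C ∧ ℒ.Adj p.1 p.2}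

theorem ncard_edges_le (C : Set ℒ.B) : (ℒ.edges C).ncard ≤ C.ncard * C.ncard := by
  have := ℒ.finite
  rw [← Set.ncard_prod]
  exact Set.ncard_le_ncard fun p hp => ⟨hp.1, hp.2.1⟩

/-- A potential which decreases under the projections which are not isomorphisms. -/
noncomputable def potential (ℒ : Level.{u₁, u₂, u₃, u₄, u₅} A) (n : ℕ) (C : Set ℒ.B) : ℕ :=
  C.ncard * (n * n + 1) + (n * n - (ℒ.edges C).ncard)

/-- A failure of injectivity loses a vertex, worth `n * n + 1`, more than the edge term can regain.
An injective projection that does not reflect adjacency gains an edge. -/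
theorem potential_image_lt {n : ℕ} {C : Set (ℒ.next 2).B} (hn : C.ncard ≤ n)
    (h : ¬ (Set.InjOn (nextProj (ℒ := ℒ) (q := 2)) C ∧
      ∀ b ∈ C, ∀ b' ∈ C, ℒ.Adj (nextProj b) (nextProj b') → (ℒ.next 2).Adj b b')) :
    ℒ.potential n (nextProj '' C) < (ℒ.next 2).potential n C := by
  have := ℒ.finite
  have := (ℒ.next 2).finite
  unfold potential
  by_cases hinj : Set.InjOn (nextProj (ℒ := ℒ) (q := 2)) C
  · rw [hinj.ncard_image]
    have h' : ∃ b ∈ C, ∃ b' ∈ C, ℒ.Adj (nextProj b) (nextProj b') ∧ ¬ (ℒ.next 2).Adj b b' := by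
      by_contra! h'
      exact h ⟨hinj, h'⟩
    obtain ⟨b, hb, b', hb', hbb, hnot⟩ := h'
    have hle := ncard_edges_le (ℒ := ℒ) (nextProj '' C)
    rw [hinj.ncard_image] at hle
    have hle2 : (ℒ.edges (nextProj '' C)).ncard ≤ n * n := hle.trans (Nat.mul_le_mul hn hn)
    have hi : Set.InjOn (Prod.map (nextProj (ℒ := ℒ) (q := 2)) (nextProj (ℒ := ℒ) (q := 2)))
        ((ℒ.next 2).edges C) := by
      intro p hp p' hp' hpp
      obtain ⟨h1, h2⟩ := Prod.ext_iff.1 hpp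
      exact Prod.ext (hinj hp.1 hp'.1 h1) (hinj hp.2.1 hp'.2.1 h2)
    have hlt : ((ℒ.next 2).edges C).ncard < (ℒ.edges (nextProj '' C)).ncard := by
      rw [← hi.ncard_image]
      refine Set.ncard_lt_ncard ⟨?_, fun hsub => ?_⟩
      · rintro _ ⟨p, hp, rfl⟩
        exact ⟨⟨p.1, hp.1, rfl⟩, ⟨p.2, hp.2.1, rfl⟩, hp.2.2.proj⟩
      · obtain ⟨p, hp, hpp⟩ := hsub (show (nextProj b, nextProj b') ∈ _ from
          ⟨⟨b, hb, rfl⟩, ⟨b', hb', rfl⟩, hbb⟩)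
        obtain ⟨h1, h2⟩ := Prod.ext_iff.1 hpp
        have e1 := hinj hp.1 hb h1
        have e2 := hinj hp.2.1 hb' h2
        exact hnot (e1 ▸ e2 ▸ hp.2.2)
    omega
  · have hlt : (nextProj (ℒ := ℒ) (q := 2) '' C).ncard < C.ncard := by
      refine lt_of_le_of_ne (Set.ncard_image_le) fun heq => hinj ?_
      exact Set.injOn_of_ncard_image_eq heq
    have : ((nextProj (ℒ := ℒ) (q := 2) '' C).ncard + 1) * (n * n + 1) ≤ C.ncard * (n * n + 1) :=
      Nat.mul_le_mul_right _ hlt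
    rw [Nat.add_mul] at this
    omega

/-- There are levels all of whose cliques are good. -/
theorem exists_good_level (ℒ : Level.{u₁, u₂, u₃, u₄, max u₃ u₄ u₅} A) (hℒ : ℒ.Compat) :
    ∃ ℒ' : Level.{u₁, u₂, u₃, u₄, max u₃ u₄ u₅} A, ℒ'.Compat ∧
      ∀ K, ℒ'.IsClique K → ℒ'.Good K := by
  have := ℒ.finite
  -- Cliques project injectively to cliques, so their size never exceeds the number of vertices of
  -- the initial level and the iteration may stop there.
  have key : ∀ m : ℕ, ∃ ℒ' : Level.{u₁, u₂, u₃, u₄, max u₃ u₄ u₅} A, ℒ'.Compat ∧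
      (∀ K, ℒ'.IsClique K → K.ncard ≤ Nat.card ℒ.B) ∧
      ∀ K, ℒ'.IsClique K → K.ncard ≤ m → ℒ'.Good K := by
    intro m
    induction m with
    | zero =>
      refine ⟨ℒ, hℒ, fun K _ => ?_, fun K _ hK => ⟨ℒ.pt, ?_⟩⟩
      · rw [← Set.ncard_univ]
        exact Set.ncard_le_ncard (Set.subset_univ _)
      · rw [(Set.ncard_eq_zero (Set.toFinite K)).1 (Nat.le_zero.1 hK)]
        exact Set.empty_subset _
    | succ m ih =>
      obtain ⟨ℒ', h1, h2, h3⟩ := ih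
      refine ⟨ℒ'.next m, compat_next h1 m, fun K hK => ?_, fun K hK hm => ?_⟩
      · rw [← hK.injOn_proj.ncard_image]
        exact h2 _ hK.image_proj
      · rcases Nat.le_succ_iff.1 hm with hm | hm
        · refine hK.good_of_good_image h1 (h3 _ hK.image_proj ?_)
          rwa [hK.injOn_proj.ncard_image]
        · exact hK.good_of_ncard h1 hm
  obtain ⟨ℒ', h1, h2, h3⟩ := key (Nat.card ℒ.B)
  exact ⟨ℒ', h1, fun K hK => h3 K hK (h2 K hK)⟩

/-- There are levels all of whose cliques are good and all of whose small subsets can be mapped to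
`M`. -/
theorem exists_real_level (ℒ : Level.{u₁, u₂, u₃, u₄, max u₃ u₄ u₅} A) (hℒ : ℒ.Compat)
    (hj : j.perm = 1) (hext : ∀ f : A.PartialAut, ∃ e : M.Aut, e.Extends j f) (n : ℕ) :
    ∃ ℒ' : Level.{u₁, u₂, u₃, u₄, max u₃ u₄ u₅} A, ℒ'.Compat ∧
      (∀ K, ℒ'.IsClique K → ℒ'.Good K) ∧
      ∀ C : Set ℒ'.B, (∀ b ∈ C, ℒ'.Adj b b) → C.ncard ≤ n → ℒ'.Real j C := by
  -- Cliques are made good first, since gluing needs the separating cliques inside charts. Each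
  -- further refinement then handles one more value of the potential.
  have key : ∀ k : ℕ, ∃ ℒ' : Level.{u₁, u₂, u₃, u₄, max u₃ u₄ u₅} A, ℒ'.Compat ∧
      (∀ K, ℒ'.IsClique K → ℒ'.Good K) ∧
      ∀ C : Set ℒ'.B, (∀ b ∈ C, ℒ'.Adj b b) → C.ncard ≤ n → ℒ'.potential n C < k →
        ℒ'.Real j C := by
    intro k
    induction k with
    | zero =>
      obtain ⟨ℒ', h1, h2⟩ := exists_good_level.{u₁, u₂, u₃, u₄, u₅} ℒ hℒ
      exact ⟨ℒ', h1, h2, fun _ _ _ h => absurd h (Nat.not_lt_zero _)⟩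
    | succ k ih =>
      obtain ⟨ℒ', h1, h2, h3⟩ := ih
      have := ℒ'.finite
      have := (ℒ'.next 2).finite
      refine ⟨ℒ'.next 2, compat_next h1 2, isClique_good_next h1 h2 2, fun C hC hn hk => ?_⟩
      by_cases h : Set.InjOn (nextProj (ℒ := ℒ') (q := 2)) C ∧
        ∀ b ∈ C, ∀ b' ∈ C, ℒ'.Adj (nextProj b) (nextProj b') → (ℒ'.next 2).Adj b b'
      · exact real_of_injOn h1 h2 hj hext hC h.1 h.2
      · refine Real.of_image_proj (h3 _ ?_ (le_trans (Set.ncard_image_le (Set.toFinite C)) hn) ?_)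
        · rintro _ ⟨b, hb, rfl⟩
          exact (hC b hb).proj
        · have := potential_image_lt hn h
          omega
  obtain ⟨ℒ', h1, h2, h3⟩ := key (n * (n * n + 1) + n * n + 1)
  refine ⟨ℒ', h1, h2, fun C hC hn => h3 C hC hn ?_⟩
  have := Nat.mul_le_mul_right (n * n + 1) hn
  unfold potential
  omega

end Level

end EPPA

/-! ### A compatible level from labels in `ZMod p` -/

namespace EPPA

open Str

universe u₁ u₂ u₃

section Spread

variable {V : Type u₃} [Fintype V] {p : ℕ} [Fact p.Prime]

open Classical in
/-- The function which agrees with `d` on `D` and is constant on the complement of `D`, with the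
constant chosen such that the sum over `S` vanishes. -/
noncomputable def spread (D S : Set V) (d : V → ZMod p) (x : V) : ZMod p :=
  if x ∈ D then d x else
    -(∑ y, if y ∈ S ∧ y ∈ D then d y else 0) / ∑ y, if y ∈ S ∧ y ∉ D then 1 else 0

theorem spread_of_mem {D S : Set V} {d : V → ZMod p} {x : V} (hx : x ∈ D) :
    spread D S d x = d x := if_pos hx

-- If `S` leaves `D`, the constant is chosen to cancel the sum; `p` exceeds the number of vertices,
-- so the count of `S \ D` is invertible. If `S ⊆ D` there is no freedom and the sum must vanish by
-- itself.
open Classical in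
theorem sum_spread (hp : Fintype.card V < p) {D S : Set V} {d : V → ZMod p}
    (h : S ⊆ D → (∑ y, if y ∈ S then d y else 0) = 0) :
    (∑ y, if y ∈ S then spread D S d y else 0) = 0 := by
  by_cases hS : S ⊆ D
  · refine (Finset.sum_congr rfl fun y _ => ?_).trans (h hS)
    split_ifs with hy
    · exact spread_of_mem (hS hy)
    · rfl
  · have hne : (∑ y : V, if y ∈ S ∧ y ∉ D then (1 : ZMod p) else 0) ≠ 0 := by
      rw [Finset.sum_boole, Ne, ZMod.natCast_eq_zero_iff]
      obtain ⟨y, hy, hyD⟩ := Set.not_subset.1 hS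
      refine Nat.not_dvd_of_pos_of_lt (Finset.card_pos.2 ⟨y, by simp [hy, hyD]⟩) ?_
      exact (Finset.card_le_univ _).trans_lt hp
    have key : ∀ y, (if y ∈ S then spread D S d y else 0) =
        (if y ∈ S ∧ y ∈ D then d y else 0) + (if y ∈ S ∧ y ∉ D then 1 else 0) *
          (-(∑ y, if y ∈ S ∧ y ∈ D then d y else 0) / ∑ y, if y ∈ S ∧ y ∉ D then 1 else 0) := by
      intro y
      unfold spread
      by_cases h1 : y ∈ S <;> by_cases h2 : y ∈ D <;> simp [h1, h2]
    rw [Finset.sum_congr rfl fun y _ => key y, Finset.sum_add_distrib, ← Finset.sum_mul,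
      mul_div_cancel₀ _ hne]
    ring

-- `spread` is linear in the function and natural under permutations carrying `D` and `S` along.
-- This is why the label corrections compose.
open Classical in
theorem spread_add {D D' S S' : Set V} (e : Equiv.Perm V) (hD : ∀ x, e x ∈ D' ↔ x ∈ D)
    (hS : ∀ x, e x ∈ S' ↔ x ∈ S) (d₁ d₂ : V → ZMod p) (x : V) :
    spread D S (fun x => d₁ x + d₂ (e x)) x = spread D S d₁ x + spread D' S' d₂ (e x) := by
  have h1 : (∑ y, if y ∈ S' ∧ y ∈ D' then d₂ y else 0) =
      ∑ y, if y ∈ S ∧ y ∈ D then d₂ (e y) else 0 := by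
    rw [← Equiv.sum_comp e]
    simp only [hD, hS]
  have h2 : (∑ y, if y ∈ S' ∧ y ∉ D' then (1 : ZMod p) else 0) =
      ∑ y, if y ∈ S ∧ y ∉ D then 1 else 0 := by
    rw [← Equiv.sum_comp e]
    simp only [hD, hS]
  have h3 : (∑ y, if y ∈ S ∧ y ∈ D then d₁ y + d₂ (e y) else 0) =
      (∑ y, if y ∈ S ∧ y ∈ D then d₁ y else 0) + ∑ y, if y ∈ S ∧ y ∈ D then d₂ (e y) else 0 := by
    rw [← Finset.sum_add_distrib]
    refine Finset.sum_congr rfl fun y _ => ?_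
    split_ifs <;> simp
  unfold spread
  rw [h1, h2, h3]
  simp only [hD]
  split_ifs
  · rfl
  · ring

end Spread

variable {L : PermLanguage.{u₁, u₂}} {V : Type u₃}

namespace Str

/-- The action on structures by relabelling and by moving the vertices. -/
instance : MulAction (L.Γ × Equiv.Perm V) (Str L V) where
  smul g A :=
    { rel := fun R => {x | (fun i => g.2.symm (x i)) ∈ A.rel (L.onRel g.1⁻¹ R)}
      fn := fun F x => {y | g.2.symm y ∈ A.fn (L.onFn g.1⁻¹ F) (g.2.symm x)} }
  one_smul _ := rfl
  mul_smul _ _ _ := rfl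

theorem mem_smul_rel (g : L.Γ × Equiv.Perm V) (A : Str L V) {n : ℕ+} (R : L.Rel n)
    (x : Fin (n : ℕ) → V) :
    x ∈ (g • A).rel R ↔ (fun i => g.2.symm (x i)) ∈ A.rel (L.onRel g.1⁻¹ R) := Iff.rfl

theorem mem_smul_fn (g : L.Γ × Equiv.Perm V) (A : Str L V) (F : L.Fn) (x y : V) :
    y ∈ (g • A).fn F x ↔ g.2.symm y ∈ A.fn (L.onFn g.1⁻¹ F) (g.2.symm x) := Iff.rfl

/-- Only finitely many permutations of the vertices are added to a finite orbit. This makes `Mark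
A`, and with it the set of labels, finite. -/
theorem finite_orbit_prod [Finite V] {A : Str L V} (h : (MulAction.orbit L.Γ A).Finite) :
    Finite (MulAction.orbit (L.Γ × Equiv.Perm V) A) := by
  have : (⋃ σ : Equiv.Perm V, (fun B : Str L V => ((1 : L.Γ), σ) • B) ''
      MulAction.orbit L.Γ A).Finite := Set.finite_iUnion fun σ => h.image _
  refine (this.subset ?_).to_subtype
  rintro _ ⟨g, rfl⟩
  exact Set.mem_iUnion.2 ⟨g.2, g.1 • A, ⟨g.1, rfl⟩, rfl⟩

/-- The structures `A` and `B` have the same relations and functions on `S`. -/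
structure Agree (S : Set V) (A B : Str L V) : Prop where
  rel : ∀ {n : ℕ+} (R : L.Rel n) (x : Fin (n : ℕ) → V), (∀ i, x i ∈ S) →
    (x ∈ A.rel R ↔ x ∈ B.rel R)
  fn : ∀ (F : L.Fn), ∀ x ∈ S, A.fn F x = B.fn F x

theorem Agree.rfl {S : Set V} {A : Str L V} : Agree S A A :=
  ⟨fun _ _ _ => Iff.rfl, fun _ _ _ => Eq.refl _⟩

theorem Agree.symm {S : Set V} {A B : Str L V} (h : Agree S A B) : Agree S B A :=
  ⟨fun R x hx => (h.rel R x hx).symm, fun F x hx => (h.fn F x hx).symm⟩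

theorem Agree.trans {S : Set V} {A B C : Str L V} (h : Agree S A B) (h' : Agree S B C) :
    Agree S A C :=
  ⟨fun R x hx => (h.rel R x hx).trans (h'.rel R x hx),
    fun F x hx => (h.fn F x hx).trans (h'.fn F x hx)⟩

theorem Agree.smul {S : Set V} {A B : Str L V} (h : Agree S A B) (g : L.Γ × Equiv.Perm V) :
    Agree {b | g.2.symm b ∈ S} (g • A) (g • B) where
  rel R x hx := h.rel _ _ hx
  fn F x hx := by
    ext y
    rw [mem_smul_fn, mem_smul_fn, h.fn _ _ hx]

theorem agree_preimage_iff (g : L.Γ × Equiv.Perm V) (S : Set V) (A B : Str L V) :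
    Agree {b | g.2 b ∈ S} A (g⁻¹ • B) ↔ Agree S (g • A) B := by
  constructor
  · intro h
    have := h.smul g
    rw [smul_inv_smul] at this
    simpa using this
  · intro h
    have := h.smul g⁻¹
    rw [inv_smul_smul] at this
    exact this

end Str

namespace Str.PartialAut

variable {A : Str L V}

/-- The graph of the vertex part of a partial automorphism. -/
def graph (f : A.PartialAut) : Set (V × V) := Set.range fun x : f.dom => ((x : V), (f.toEquiv x : V))

theorem isPartialInj_graph (f : A.PartialAut) : IsPartialInj f.graph := by
  rintro _ ⟨x, rfl⟩ _ ⟨y, rfl⟩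
  rw [← Subtype.ext_iff, ← Subtype.ext_iff, f.toEquiv.injective.eq_iff]

variable [Finite V]

/-- The language part of a partial automorphism together with an extension of its vertex part. -/
noncomputable def extend (f : A.PartialAut) : L.Γ × Equiv.Perm V := (f.perm, extendPerm f.graph)

theorem extend_apply (f : A.PartialAut) (x : f.dom) : f.extend.2 x = f.toEquiv x :=
  extendPerm_apply f.isPartialInj_graph ⟨x, rfl⟩

theorem extend_symm_apply (f : A.PartialAut) (x : f.cod) :
    f.extend.2.symm x = f.toEquiv.symm x := by
  rw [Equiv.symm_apply_eq, extend_apply]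
  simp

theorem extend_mem_cod_iff (f : A.PartialAut) (x : V) : f.extend.2 x ∈ f.cod ↔ x ∈ f.dom := by
  constructor
  · intro h
    have := f.extend_symm_apply ⟨_, h⟩
    rw [Equiv.symm_apply_apply] at this
    rw [this]
    exact (f.toEquiv.symm _).2
  · intro h
    rw [f.extend_apply ⟨x, h⟩]
    exact (f.toEquiv _).2

theorem extend_coherent {f g h : A.PartialAut} (hc : f.IsCoherentTriple g h) :
    h.extend = g.extend * f.extend := by
  refine Prod.ext hc.perm_eq (extendPerm_comp f.isPartialInj_graph g.isPartialInj_graph ?_ ?_)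
  · ext z
    constructor
    · rintro ⟨_, ⟨x, rfl⟩, rfl⟩
      exact ⟨_, ⟨⟨f.toEquiv x, by rw [← hc.mid_eq]; exact (f.toEquiv x).2⟩, rfl⟩, rfl⟩
    · rintro ⟨_, ⟨y, rfl⟩, rfl⟩
      have hy : (y : V) ∈ f.cod := by rw [hc.mid_eq]; exact y.2
      exact ⟨_, ⟨f.toEquiv.symm ⟨y, hy⟩, rfl⟩, by simp⟩
  · ext ⟨a, b⟩
    constructor
    · rintro ⟨z, hz⟩
      obtain ⟨rfl, rfl⟩ := Prod.ext_iff.1 hz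
      have hz' : (z : V) ∈ f.dom := by rw [hc.dom_eq]; exact z.2
      have hy : (f.toEquiv ⟨z, hz'⟩ : V) ∈ g.dom := by
        rw [← hc.mid_eq]; exact (f.toEquiv _).2
      exact ⟨_, ⟨⟨z, hz'⟩, rfl⟩, ⟨⟨_, hy⟩,
        Prod.ext rfl (hc.map_eq ⟨z, hz'⟩ ⟨_, hy⟩ z rfl rfl).symm⟩⟩
    · rintro ⟨y, ⟨x, hx⟩, ⟨y', hy⟩⟩
      obtain ⟨rfl, hx2⟩ := Prod.ext_iff.1 hx
      obtain ⟨hy1, rfl⟩ := Prod.ext_iff.1 hy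
      have hx' : (x : V) ∈ h.dom := by rw [← hc.dom_eq]; exact x.2
      exact ⟨⟨x, hx'⟩, Prod.ext rfl (hc.map_eq x y' ⟨x, hx'⟩ rfl (hy1.trans hx2.symm))⟩

/-- Off `f.dom` the extension ignores the structure, so agreement with `A` is available only on the
range of `f`. -/
theorem agree_extend (f : A.PartialAut) : Agree f.cod (f.extend • A) A where
  rel R x hx := by
    have h1 := f.mem_rel_iff (L.onRel f.perm⁻¹ R) fun i => f.toEquiv.symm ⟨x i, hx i⟩
    rw [onRel_onRel_inv] at h1
    simp only [Equiv.apply_symm_apply] at h1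
    rw [← h1, mem_smul_rel]
    have : (fun i => f.extend.2.symm (x i)) = fun i => (f.toEquiv.symm ⟨x i, hx i⟩ : V) :=
      funext fun i => f.extend_symm_apply ⟨x i, hx i⟩
    rw [this]
    rfl
  fn F x hx := by
    have h1 := f.image_fn (L.onFn f.perm⁻¹ F) (f.toEquiv.symm ⟨x, hx⟩)
    rw [onFn_onFn_inv, Equiv.apply_symm_apply] at h1
    rw [← h1]
    ext y
    rw [mem_smul_fn, f.extend_symm_apply ⟨x, hx⟩]
    constructor
    · intro hy
      have hy' : f.extend.2.symm y ∈ f.dom :=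
        f.dom_closed _ _ (f.toEquiv.symm ⟨x, hx⟩).2 hy
      refine ⟨⟨_, hy'⟩, hy, ?_⟩
      exact (f.extend_apply _).symm.trans (by simp)
    · rintro ⟨z, hz, rfl⟩
      have : f.extend.2.symm (f.toEquiv z) = z := by
        rw [← f.extend_apply, Equiv.symm_apply_apply]
      beta_reduce
      rw [this]
      exact hz

end Str.PartialAut

/-- The level given by all permutations of the vertex set. -/
noncomputable def permLevel [Finite V] (A : Str L V) : Level.{u₁, u₂, u₃, u₃, max u₁ u₂ u₃} A where
  B := V
  finite := inferInstance
  E := L.Γ × Equiv.Perm V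
  perm ε := ε.1
  map ε := ε.2
  injective ε := ε.2.injective
  pt := 1
  perm_pt := rfl
  Φ ε₁ ε₂ f := (ε₂ * f.extend * ε₁⁻¹).2
  Φ_map ε₁ ε₂ f x := by simp [f.extend_apply]
  Φ_chart ε₁ ε₂ f ε := ⟨ε₂ * f.extend * ε₁⁻¹ * ε, rfl, fun _ => rfl⟩
  Φ_coherent ε₁ ε₂ ε₃ f g h hc := by
    rw [PartialAut.extend_coherent hc]
    ext1 x
    simp

variable {A : Str L V}

/-- A set of vertices and a structure from the orbit of `A`. -/
abbrev Mark (A : Str L V) := Set V × MulAction.orbit (L.Γ × Equiv.Perm V) A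

/-- The mark which is mapped to a given mark by `g`. -/
def Mark.pull (g : L.Γ × Equiv.Perm V) (i : Mark A) : Mark A := ({b | g.2 b ∈ i.1}, g⁻¹ • i.2)

theorem Mark.pull_mul (g h : L.Γ × Equiv.Perm V) (i : Mark A) :
    i.pull (g * h) = (i.pull g).pull h := by
  unfold pull
  rw [mul_inv_rev, mul_smul]
  rfl

theorem Mark.pull_pull_inv (g : L.Γ × Equiv.Perm V) (i : Mark A) : (i.pull g⁻¹).pull g = i := by
  rw [← pull_mul, inv_mul_cancel]
  unfold pull
  rw [inv_one, one_smul]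
  rfl

open Classical in
/-- The labels of the vertices of `S` sum up to the indicator of the property that the chart
carries the structure `θ` on `S`. -/
def MarkGen [Fintype V] (A : Str L V) (p : ℕ) (ε : L.Γ × Equiv.Perm V)
    (l : V → Mark A → ZMod p) : Prop :=
  ∀ i : Mark A, i.1.Nonempty →
    (∑ x, if ε.2 x ∈ i.1 then l x i else 0) = if Agree i.1 (ε • A) i.2 then 1 else 0

-- Put the whole required sum on a single vertex. The empty set has to be excluded in `MarkGen`: its
-- sum is `0`, while agreement on it always holds.
open Classical in
theorem exists_markGen [Fintype V] (A : Str L V) (p : ℕ) (ε : L.Γ × Equiv.Perm V) :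
    ∃ l, MarkGen A p ε l := by
  have : ∀ i : Mark A, ∃ l : V → ZMod p, i.1.Nonempty →
      (∑ x, if ε.2 x ∈ i.1 then l x else 0) = if Agree i.1 (ε • A) i.2 then 1 else 0 := by
    intro i
    by_cases hi : i.1.Nonempty
    · obtain ⟨s, hs⟩ := hi
      refine ⟨Pi.single (ε.2.symm s) (if Agree i.1 (ε • A) i.2 then 1 else 0), fun _ => ?_⟩
      rw [Finset.sum_eq_single (ε.2.symm s)]
      · simp [hs]
      · intro x _ hx
        simp [Pi.single_eq_of_ne hx]
      · intro h
        exact absurd (Finset.mem_univ _) h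
    · exact ⟨0, fun h => absurd h hi⟩
  choose l hl using this
  exact ⟨fun x i => l i x, hl⟩

abbrev MarkChart [Fintype V] (A : Str L V) (p : ℕ) :=
  {c : (L.Γ × Equiv.Perm V) × (V → Mark A → ZMod p) // MarkGen A p c.1 c.2}

section MarkScheme

variable [Fintype V] {p : ℕ} [Fact p.Prime]

/-- The correction of the labels for a partial isomorphism between two charts. -/
noncomputable def markShift (c₁ c₂ : MarkChart A p) (f : A.PartialAut) (i : Mark A) (x : V) :
    ZMod p :=
  spread f.dom {x | c₂.1.1.2 (f.extend.2 x) ∈ i.1}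
    (fun x => c₂.1.2 (f.extend.2 x) i - c₁.1.2 x (i.pull (c₂.1.1 * f.extend * c₁.1.1⁻¹))) x

/-- The differences of labels along `f` and `g` telescope, and `spread_add` carries this over to the
complement of the domain. -/
theorem markShift_coherent (c₁ c₂ c₃ : MarkChart A p) {f g h : A.PartialAut}
    (hc : f.IsCoherentTriple g h) (i : Mark A) (x : V) :
    markShift c₁ c₃ h i x = markShift c₁ c₂ f (i.pull (c₃.1.1 * g.extend * c₂.1.1⁻¹)) x +
      markShift c₂ c₃ g i (f.extend.2 x) := by
  have hmul : c₃.1.1 * h.extend * c₁.1.1⁻¹ =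
      (c₃.1.1 * g.extend * c₂.1.1⁻¹) * (c₂.1.1 * f.extend * c₁.1.1⁻¹) := by
    rw [PartialAut.extend_coherent hc]; group
  unfold markShift
  have hS : ∀ x, f.extend.2 x ∈ {y | c₃.1.1.2 (g.extend.2 y) ∈ i.1} ↔
      x ∈ {y | c₂.1.1.2 (f.extend.2 y) ∈ (i.pull (c₃.1.1 * g.extend * c₂.1.1⁻¹)).1} := by
    intro x
    simp [Mark.pull]
  have hD : ∀ x, f.extend.2 x ∈ g.dom ↔ x ∈ f.dom := by
    intro x
    rw [← hc.mid_eq, f.extend_mem_cod_iff]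
  rw [← spread_add f.extend.2 hD hS, ← hc.dom_eq]
  congr 1
  · ext x
    rw [← hS]
    simp [PartialAut.extend_coherent hc]
  · ext x
    rw [hmul, Mark.pull_mul, PartialAut.extend_coherent hc]
    simp

-- The only case without freedom is a marked set covered by the image of `f.dom`. There `f`
-- preserves the structure, so both charts have the same indicator and their label sums cancel.
open Classical in
theorem sum_markShift (hp : Fintype.card V < p) (c₁ c₂ : MarkChart A p) (f : A.PartialAut)
    (i : Mark A) (hi : i.1.Nonempty) :
    (∑ x, if c₂.1.1.2 (f.extend.2 x) ∈ i.1 then markShift c₁ c₂ f i x else 0) = 0 := by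
  refine sum_spread hp fun hsub => ?_
  set g := c₂.1.1 * f.extend * c₁.1.1⁻¹ with hg
  have hpull : (i.pull g).1.Nonempty := by
    obtain ⟨s, hs⟩ := hi
    exact ⟨g.2.symm s, by simpa [Mark.pull] using hs⟩
  have h1 := c₁.2 (i.pull g) hpull
  have h2 := c₂.2 i hi
  have hmem : ∀ x, c₁.1.1.2 x ∈ (i.pull g).1 ↔ c₂.1.1.2 (f.extend.2 x) ∈ i.1 := by
    intro x
    simp [Mark.pull, hg]
  simp only [hmem] at h1
  rw [← Equiv.sum_comp f.extend.2] at h2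
  have hagree : Agree i.1 (c₂.1.1 • A) i.2 ↔ Agree (i.pull g).1 (c₁.1.1 • A) (i.pull g).2 := by
    have e1 : Agree (i.pull g).1 (c₁.1.1 • A) (i.pull g).2 ↔ Agree i.1 (g • c₁.1.1 • A) i.2 :=
      agree_preimage_iff g i.1 (c₁.1.1 • A) i.2
    have e2 : g • c₁.1.1 • A = c₂.1.1 • f.extend • A := by
      rw [← mul_smul, ← mul_smul, hg, inv_mul_cancel_right]
    have e3 := f.agree_extend.smul c₂.1.1
    have e4 : Agree i.1 (c₂.1.1 • f.extend • A) (c₂.1.1 • A) := by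
      have hs : ∀ b ∈ i.1, b ∈ {b | c₂.1.1.2.symm b ∈ f.cod} := by
        intro b hb
        have : f.extend.2.symm (c₂.1.1.2.symm b) ∈ f.dom := hsub (by
          change c₂.1.1.2 (f.extend.2 (f.extend.2.symm (c₂.1.1.2.symm b))) ∈ i.1
          simpa using hb)
        rw [← f.extend_mem_cod_iff, Equiv.apply_symm_apply] at this
        exact this
      exact ⟨fun R x hx => e3.rel R x fun i => hs _ (hx i), fun F x hx => e3.fn F x (hs x hx)⟩
    rw [e1, e2]
    exact ⟨fun h => e4.trans h, fun h => e4.symm.trans h⟩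
  have h3 := h2.trans ((if_congr hagree rfl rfl).trans h1.symm)
  rw [← sub_eq_zero, ← Finset.sum_sub_distrib] at h3
  refine Eq.trans (Finset.sum_congr rfl fun x _ => ?_) h3
  change (if c₂.1.1.2 (f.extend.2 x) ∈ i.1 then
    c₂.1.2 (f.extend.2 x) i - c₁.1.2 x (i.pull g) else 0) = _
  split_ifs <;> simp

/-- The labelling scheme which makes the structure of a chart a function of the labels. -/
noncomputable def markScheme (horbit : (MulAction.orbit L.Γ A).Finite) (hp : Fintype.card V < p) :
    Scheme.{u₁, u₂, u₃, u₃, max u₁ u₂ u₃, max u₁ u₂ u₃} (permLevel A) where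
  Lab := Mark A → ZMod p
  finite := by
    have := finite_orbit_prod horbit
    have : NeZero p := ⟨(Fact.out : p.Prime).ne_zero⟩
    infer_instance
  Gen := MarkGen A p
  exists_gen := exists_markGen A p _
  T (c₁ c₂ : MarkChart A p) f := Equiv.ofBijective
    (fun b => ((c₂.1.1 * f.extend * c₁.1.1⁻¹).2 b.1, fun i =>
      b.2 (i.pull (c₂.1.1 * f.extend * c₁.1.1⁻¹)) + markShift c₁ c₂ f i (c₁.1.1.2.symm b.1))) (by
      have := finite_orbit_prod horbit
      have : NeZero p := ⟨(Fact.out : p.Prime).ne_zero⟩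
      have : Finite (permLevel A).B := inferInstanceAs (Finite V)
      refine Function.Injective.bijective_of_finite ?_
      rintro ⟨b, l⟩ ⟨b', l'⟩ h
      obtain ⟨h1, h2⟩ := Prod.ext_iff.1 h
      obtain rfl : b = b' := (Equiv.injective _) h1
      refine Prod.ext rfl (funext fun i => ?_)
      -- Each mark is a pull-back, and the shift depends on the vertex but not on the label, so it
      -- cancels.
      have := congrFun h2 (i.pull (c₂.1.1 * f.extend * c₁.1.1⁻¹)⁻¹)
      simpa only [Mark.pull_pull_inv, add_left_inj] using this)
  T_map (c₁ c₂ : MarkChart A p) f x := by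
    refine Prod.ext ?_ (funext fun i => ?_)
    · exact (permLevel A).Φ_map _ _ f x
    · change c₁.1.2 x _ + markShift c₁ c₂ f i (c₁.1.1.2.symm (c₁.1.1.2 x)) = c₂.1.2 (f.toEquiv x) i
      rw [Equiv.symm_apply_apply, markShift, spread_of_mem x.2, f.extend_apply]
      ring
  T_chart (c₁ c₂ : MarkChart A p) f (c : MarkChart A p) := by
    classical
    set g := c₂.1.1 * f.extend * c₁.1.1⁻¹ with hg
    refine ⟨⟨(g * c.1.1, fun x i => c.1.2 x (i.pull g) +
      markShift c₁ c₂ f i (c₁.1.1.2.symm (c.1.1.2 x))), ?_⟩, rfl, fun x => rfl⟩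
    intro i hi
    have hpull : (i.pull g).1.Nonempty := by
      obtain ⟨s, hs⟩ := hi
      exact ⟨g.2.symm s, by simpa [Mark.pull] using hs⟩
    have h1 := c.2 (i.pull g) hpull
    have h2 := sum_markShift hp c₁ c₂ f i hi
    rw [← Equiv.sum_comp (c.1.1.2.trans c₁.1.1.2.symm)] at h2
    have hagree : Agree (i.pull g).1 (c.1.1 • A) (i.pull g).2 ↔ Agree i.1 ((g * c.1.1) • A) i.2 := by
      rw [mul_smul]
      exact agree_preimage_iff g i.1 (c.1.1 • A) i.2
    have h3 := congrArg₂ (· + ·) (h1.trans (if_congr hagree rfl rfl)) h2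
    simp only [add_zero, ← Finset.sum_add_distrib] at h3
    rw [← h3]
    refine Finset.sum_congr rfl fun x _ => ?_
    have e1 : (g * c.1.1).2 x ∈ i.1 ↔ c.1.1.2 x ∈ (i.pull g).1 := Iff.rfl
    have e2 : c₂.1.1.2 (f.extend.2 ((c.1.1.2.trans c₁.1.1.2.symm) x)) ∈ i.1 ↔
        c.1.1.2 x ∈ (i.pull g).1 := Iff.rfl
    by_cases hx : c.1.1.2 x ∈ (i.pull g).1
    · rw [if_pos (e1.2 hx), if_pos hx, if_pos (e2.2 hx)]
      rfl
    · rw [if_neg (mt e1.1 hx), if_neg hx, if_neg (mt e2.1 hx), add_zero]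
  T_coherent (c₁ c₂ c₃ : MarkChart A p) f f' h hc := by
    have hmul : c₃.1.1 * h.extend * c₁.1.1⁻¹ =
        (c₃.1.1 * f'.extend * c₂.1.1⁻¹) * (c₂.1.1 * f.extend * c₁.1.1⁻¹) := by
      rw [PartialAut.extend_coherent hc]; group
    ext1 b
    refine Prod.ext ?_ (funext fun i => ?_)
    · change (c₃.1.1 * h.extend * c₁.1.1⁻¹).2 b.1 = _
      rw [hmul]; rfl
    · change b.2 (i.pull _) + markShift c₁ c₃ h i (c₁.1.1.2.symm b.1) = (b.2 (Mark.pull _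
        (i.pull _)) + markShift c₁ c₂ f _ (c₁.1.1.2.symm b.1)) + markShift c₂ c₃ f' i
          (c₂.1.1.2.symm ((c₂.1.1 * f.extend * c₁.1.1⁻¹).2 b.1))
      rw [markShift_coherent c₁ c₂ c₃ hc, hmul, Mark.pull_mul, add_assoc]
      congr 3
      exact (c₂.1.1.2.symm_apply_apply _).symm

-- Test both labellings against the mark consisting of `S` and the structure of the second chart.
-- The second sum is `1`, the sums are equal, and so the first indicator is not `0`.
open Classical in
theorem agree_of_markGen {c₁ c₂ : MarkChart A p} {S : Set V} (hS : S.Nonempty)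
    (h : ∀ b ∈ S, c₁.1.2 (c₁.1.1.2.symm b) = c₂.1.2 (c₂.1.1.2.symm b)) :
    Agree S (c₁.1.1 • A) (c₂.1.1 • A) := by
  let i : Mark A := (S, ⟨c₂.1.1 • A, c₂.1.1, rfl⟩)
  have h1 := c₁.2 i hS
  have h2 := c₂.2 i hS
  rw [← Equiv.sum_comp c₁.1.1.2.symm] at h1
  rw [← Equiv.sum_comp c₂.1.1.2.symm, if_pos Agree.rfl] at h2
  by_contra hno
  rw [if_neg hno] at h1
  refine one_ne_zero (h2.symm.trans (Eq.trans (Finset.sum_congr rfl fun b _ => ?_) h1))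
  simp only [Equiv.apply_symm_apply]
  split_ifs with hb
  · rw [h b hb]
  · rfl

theorem compat_markScheme (horbit : (MulAction.orbit L.Γ A).Finite) (hp : Fintype.card V < p) :
    (markScheme horbit hp).step.Compat := by
  -- Agreement is applied to the largest possible set, all vertices at which the two charts carry
  -- equal labels.
  have key : ∀ (c₁ c₂ : MarkChart A p) (x y : V), c₁.1.1.2 x = c₂.1.1.2 y →
      c₁.1.2 x = c₂.1.2 y →
        c₁.1.1.2 x ∈ {b | c₁.1.2 (c₁.1.1.2.symm b) = c₂.1.2 (c₂.1.1.2.symm b)} := by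
    intro c₁ c₂ x y h1 h2
    rw [Set.mem_ofPred_eq, Equiv.symm_apply_apply, h1, Equiv.symm_apply_apply, h2]
  refine Scheme.compat_step _ (fun (c₁ c₂ : MarkChart A p) n R x y hxy hx => ?_) (fun (c₁ c₂ : MarkChart A p) F x y z hxy hz => ?_)
  · have h1 : ∀ i, c₁.1.1.2 (x i) = c₂.1.1.2 (y i) := fun i => congrArg Prod.fst (hxy i)
    have h2 : ∀ i, c₁.1.2 (x i) = c₂.1.2 (y i) := fun i => congrArg Prod.snd (hxy i)
    have hm := fun i => key c₁ c₂ (x i) (y i) (h1 i) (h2 i)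
    have hag := agree_of_markGen (c₁ := c₁) (c₂ := c₂) ⟨_, hm ⟨0, n.2⟩⟩ fun b hb => hb
    have := hag.rel R (fun i => c₁.1.1.2 (x i)) hm
    rw [mem_smul_rel, mem_smul_rel] at this
    simp only [Equiv.symm_apply_apply] at this
    simp only [h1, Equiv.symm_apply_apply] at this
    exact this.1 hx
  · have h1 : c₁.1.1.2 x = c₂.1.1.2 y := congrArg Prod.fst hxy
    have h2 : c₁.1.2 x = c₂.1.2 y := congrArg Prod.snd hxy
    have hm := key c₁ c₂ x y h1 h2
    have hag := agree_of_markGen (c₁ := c₁) (c₂ := c₂) ⟨_, hm⟩ fun b hb => hb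
    have hmem : c₁.1.1.2 z ∈ (c₁.1.1 • A).fn F (c₁.1.1.2 x) := by
      rw [mem_smul_fn, Equiv.symm_apply_apply, Equiv.symm_apply_apply]
      exact hz
    rw [hag.fn F _ hm, mem_smul_fn, h1, Equiv.symm_apply_apply] at hmem
    exact ⟨_, hmem, (c₂.1.1.2.apply_symm_apply _).symm⟩

end MarkScheme

/-- Every finite structure in a finite orbit has a compatible level. -/
theorem exists_compat_level [Finite V] (A : Str L V) (horbit : (MulAction.orbit L.Γ A).Finite) :
    ∃ ℒ : Level.{u₁, u₂, u₃, max u₁ u₂ u₃, max u₁ u₂ u₃} A, ℒ.Compat := by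
  have := Fintype.ofFinite V
  obtain ⟨p, hp, hpp⟩ := Nat.exists_infinite_primes (Fintype.card V + 1)
  have : Fact p.Prime := ⟨hpp⟩
  exact ⟨_, compat_markScheme horbit (p := p) hp⟩

end EPPA

/-! ### The union of the charts as a structure -/

namespace EPPA

open Str

universe u₁ u₂ u₃ u₄ u₅ u₆ u₇

variable {L : PermLanguage.{u₁, u₂}} {V : Type u₃} {A : Str L V}

theorem Str.IsHom.isEmbedding {W : Type u₄} {Y : Type u₅} {B : Str L W} {C : Str L Y} {g : L.Γ}
    {e : W ≃ Y} (h : B.IsHom C g e) (h' : C.IsHom B g⁻¹ e.symm) : B.IsEmbedding C g e where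
  injective := e.injective
  map_rel R x := by
    refine ⟨h.map_rel R x, fun hx => ?_⟩
    have := h'.map_rel _ _ hx
    rw [onRel_inv_onRel] at this
    have hx' : e.symm ∘ e ∘ x = x := by ext i; simp
    rwa [hx'] at this
  map_fn F x := by
    refine Set.Subset.antisymm (h.map_fn F x) fun y hy => ⟨e.symm y, ?_, by simp⟩
    have := h'.map_fn _ _ ⟨y, hy, rfl⟩
    rwa [onFn_inv_onFn, Equiv.symm_apply_apply] at this

namespace Level

theorem adj_Φ_iff (ℒ : Level.{u₁, u₂, u₃, u₄, u₅} A) (ε₁ ε₂ : ℒ.E) (f : A.PartialAut) (b : ℒ.B) :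
    ℒ.Adj (ℒ.Φ ε₁ ε₂ f b) (ℒ.Φ ε₁ ε₂ f b) ↔ ℒ.Adj b b := by
  constructor
  · rintro ⟨ε, x, -, hx, -⟩
    obtain ⟨ε', hε'⟩ := ℒ.exists_chart_Φ_inv ε₁ ε₂ f ε
    have : ℒ.map ε' x = b := by rw [← hε', hx]; simp
    exact ⟨ε', x, x, this, this⟩
  · rintro ⟨ε, x, -, rfl, -⟩
    obtain ⟨ε', -, hε'⟩ := ℒ.Φ_chart ε₁ ε₂ f ε
    exact ⟨ε', x, x, (hε' x).symm, (hε' x).symm⟩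

/-- The restriction of a level to the vertices which are covered by charts. -/
def restrict (ℒ : Level.{u₁, u₂, u₃, u₄, u₅} A) {W : Type u₆} (e : {b // ℒ.Adj b b} ≃ W) :
    Level.{u₁, u₂, u₃, u₆, u₅} A where
  B := W
  finite := by
    have := ℒ.finite
    exact Finite.of_equiv _ e
  E := ℒ.E
  perm := ℒ.perm
  map ε x := e ⟨ℒ.map ε x, ε, x, x, rfl, rfl⟩
  injective ε x y h := ℒ.injective ε (congrArg Subtype.val (e.injective h))
  pt := ℒ.pt
  perm_pt := ℒ.perm_pt
  Φ ε₁ ε₂ f := e.permCongr ((ℒ.Φ ε₁ ε₂ f).subtypePerm (ℒ.adj_Φ_iff ε₁ ε₂ f))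
  Φ_map ε₁ ε₂ f x := by
    simp [Equiv.permCongr_apply, Equiv.Perm.subtypePerm_apply, ℒ.Φ_map]
  Φ_chart ε₁ ε₂ f ε := by
    obtain ⟨ε', hp, hε'⟩ := ℒ.Φ_chart ε₁ ε₂ f ε
    refine ⟨ε', hp, fun x => ?_⟩
    simp [Equiv.permCongr_apply, Equiv.Perm.subtypePerm_apply, hε']
  Φ_coherent ε₁ ε₂ ε₃ f g h hc := by
    ext1 b
    simp [Equiv.permCongr_apply, Equiv.Perm.subtypePerm_apply, ℒ.Φ_coherent ε₁ ε₂ ε₃ f g h hc]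

section Restrict

variable {ℒ : Level.{u₁, u₂, u₃, u₄, u₅} A} {W : Type u₆} (e : {b // ℒ.Adj b b} ≃ W)

theorem restrict_map_eq_iff {ε ε' : ℒ.E} {x y : V} :
    (ℒ.restrict e).map ε x = (ℒ.restrict e).map ε' y ↔ ℒ.map ε x = ℒ.map ε' y :=
  e.injective.eq_iff.trans Subtype.ext_iff

theorem symm_restrict_map (ε : ℒ.E) (x : V) :
    (e.symm ((ℒ.restrict e).map ε x) : ℒ.B) = ℒ.map ε x :=
  congrArg Subtype.val (e.symm_apply_apply _)

theorem compat_restrict (h : ℒ.Compat) : (ℒ.restrict e).Compat where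
  rel ε ε' _ R x y hxy := h.rel ε ε' R x y fun i => (restrict_map_eq_iff e).1 (hxy i)
  fn ε ε' F x y z hxy hz := by
    obtain ⟨w, hw, hzw⟩ := h.fn ε ε' F x y z ((restrict_map_eq_iff e).1 hxy) hz
    exact ⟨w, hw, (restrict_map_eq_iff e).2 hzw⟩

theorem adj_of_restrict_adj {b b' : W} (h : (ℒ.restrict e).Adj b b') :
    ℒ.Adj (e.symm b) (e.symm b') := by
  obtain ⟨ε, x, y, rfl, rfl⟩ := h
  exact ⟨ε, x, y, (symm_restrict_map e ε x).symm, (symm_restrict_map e ε y).symm⟩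

theorem restrict_adj_self (b : W) : (ℒ.restrict e).Adj b b := by
  obtain ⟨ε, x, -, hx, -⟩ := (e.symm b).2
  have : (ℒ.restrict e).map ε x = b := by
    rw [← e.apply_symm_apply b]
    exact congrArg e (Subtype.ext hx)
  exact ⟨ε, x, x, this, this⟩

theorem good_restrict (h : ∀ K, ℒ.IsClique K → ℒ.Good K) (K : Set W)
    (hK : (ℒ.restrict e).IsClique K) : (ℒ.restrict e).Good K := by
  obtain ⟨ε, hε⟩ := h ((fun b => (e.symm b : ℒ.B)) '' K) (by
    rintro _ ⟨b, hb, rfl⟩ _ ⟨b', hb', rfl⟩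
    exact adj_of_restrict_adj e (hK b hb b' hb'))
  refine ⟨ε, fun b hb => ?_⟩
  obtain ⟨x, hx⟩ := hε ⟨b, hb, rfl⟩
  refine ⟨x, ?_⟩
  rw [← e.apply_symm_apply b]
  exact congrArg e (Subtype.ext hx)

theorem real_restrict {X : Type u₇} {M : Str L X} {j : A.Emb M} {C : Set W}
    (h : ℒ.Real j ((fun b => (e.symm b : ℒ.B)) '' C)) : (ℒ.restrict e).Real j C := by
  obtain ⟨m, hm⟩ := h
  refine ⟨fun b => m ⟨e.symm b.1, b.1, b.2, rfl⟩, fun ε => ?_⟩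
  obtain ⟨θ, hp, hθ⟩ := hm ε
  refine ⟨θ, hp, fun x hx => ?_⟩
  rw [← hθ x ⟨_, hx, symm_restrict_map e ε x⟩]
  exact congrArg m (Subtype.ext (symm_restrict_map e ε x))

end Restrict

variable (ℒ : Level.{u₁, u₂, u₃, u₄, u₅} A)

/-- The union of the structures on the charts. -/
def toStr : Str L ℒ.B where
  rel R := {b | ∃ ε x, ℒ.map ε ∘ x = b ∧ x ∈ A.rel (L.onRel (ℒ.perm ε)⁻¹ R)}
  fn F b := {b' | ∃ ε x y, ℒ.map ε x = b ∧ ℒ.map ε y = b' ∧ y ∈ A.fn (L.onFn (ℒ.perm ε)⁻¹ F) x}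

variable {ℒ}

theorem Compat.isEmbedding_map (h : ℒ.Compat) (ε : ℒ.E) :
    A.IsEmbedding ℒ.toStr (ℒ.perm ε) (ℒ.map ε) where
  injective := ℒ.injective ε
  map_rel R x := by
    constructor
    · intro hx
      exact ⟨ε, x, rfl, by rwa [onRel_inv_onRel]⟩
    · rintro ⟨ε', y, hxy, hy⟩
      have := h.rel ε' ε _ y x (fun i => congrFun hxy i) hy
      rwa [onRel_inv_onRel] at this
  map_fn F x := by
    ext b
    constructor
    · rintro ⟨y, hy, rfl⟩
      exact ⟨ε, x, y, rfl, rfl, by rwa [onFn_inv_onFn]⟩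
    · rintro ⟨ε', x', y, hx, rfl, hy⟩
      obtain ⟨z, hz, hyz⟩ := h.fn ε' ε _ x' x y hx hy
      rw [onFn_inv_onFn] at hz
      exact ⟨z, hz, hyz.symm⟩

theorem Compat.isClosed_range (h : ℒ.Compat) (ε : ℒ.E) :
    ℒ.toStr.IsClosed (Set.range (ℒ.map ε)) := by
  rintro F _ ⟨x, rfl⟩ _ ⟨ε', x', y, hx, rfl, hy⟩
  obtain ⟨z, -, hyz⟩ := h.fn ε' ε _ x' x y hx hy
  exact ⟨z, hyz.symm⟩

variable (ℒ)

theorem isHom_Φ (ε₁ ε₂ : ℒ.E) (f : A.PartialAut) :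
    ℒ.toStr.IsHom ℒ.toStr (ℒ.perm ε₂ * f.perm * (ℒ.perm ε₁)⁻¹) (ℒ.Φ ε₁ ε₂ f) where
  map_rel R b := by
    rintro ⟨ε, x, rfl, hx⟩
    obtain ⟨ε', hp, hε'⟩ := ℒ.Φ_chart ε₁ ε₂ f ε
    refine ⟨ε', x, ?_, ?_⟩
    · ext i
      exact (hε' _).symm
    · rw [hp, mul_inv_rev, onRel_mul, onRel_inv_onRel]
      exact hx
  map_fn F b := by
    rintro _ ⟨_, ⟨ε, x, y, rfl, rfl, hy⟩, rfl⟩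
    obtain ⟨ε', hp, hε'⟩ := ℒ.Φ_chart ε₁ ε₂ f ε
    refine ⟨ε', x, y, (hε' x).symm, (hε' y).symm, ?_⟩
    rw [hp, mul_inv_rev, onFn_mul, onFn_inv_onFn]
    exact hy

/-- The automorphisms of the union of the charts which extend partial isomorphisms of charts. -/
def aut (ε₁ ε₂ : ℒ.E) (f : A.PartialAut) : ℒ.toStr.Aut where
  perm := ℒ.perm ε₂ * f.perm * (ℒ.perm ε₁)⁻¹
  toEquiv := ℒ.Φ ε₁ ε₂ f
  isEmbedding := by
    refine (ℒ.isHom_Φ ε₁ ε₂ f).isEmbedding ?_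
    have h := ℒ.isHom_Φ ε₂ ε₁ f.symm
    rw [ℒ.Φ_symm] at h
    have hp : (ℒ.perm ε₂ * f.perm * (ℒ.perm ε₁)⁻¹)⁻¹ =
        ℒ.perm ε₁ * f.symm.perm * (ℒ.perm ε₂)⁻¹ := by
      change _ = ℒ.perm ε₁ * f.perm⁻¹ * (ℒ.perm ε₂)⁻¹
      group
    rw [hp]
    exact h

variable {ℒ}

/-- The image of an irreducible structure under an embedding is a clique. -/
theorem Compat.isClique_range (h : ℒ.Compat) (hcov : ∀ b, ℒ.Adj b b) {Y : Type u₆} {D : Str L Y}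
    (hD : D.Irreducible) {g : L.Γ} {f : Y → ℒ.B} (hf : D.IsEmbedding ℒ.toStr g f) :
    ℒ.IsClique (Set.range f) := by
  rintro _ ⟨u, rfl⟩ _ ⟨v, rfl⟩
  by_contra huv
  have hclosed : ∀ b, D.IsClosed {w | b ∉ ℒ.toStr.cl (f w)} := by
    intro b F x hx y hy hb
    refine hx (cl_subset_cl ?_ hb)
    refine ℒ.toStr.isClosed_cl _ (L.onFn g F) _ (mem_cl_self _ _) ?_
    rw [← hf.map_fn]
    exact ⟨y, hy, rfl⟩
  have hno : ∀ ε x y, ℒ.map ε x ∈ {b | f u ∈ ℒ.toStr.cl b} →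
      ℒ.map ε y ∈ {b | f v ∈ ℒ.toStr.cl b} → False := by
    intro ε x y hx hy
    obtain ⟨x', hx'⟩ := cl_subset (h.isClosed_range ε) ⟨x, rfl⟩ hx
    obtain ⟨y', hy'⟩ := cl_subset (h.isClosed_range ε) ⟨y, rfl⟩ hy
    exact huv ⟨ε, x', y', hx', hy'⟩
  -- The points that do not generate `f u` and those that do not generate `f v` form closed proper
  -- subsets. Charts are closed, so a point or a related tuple violating free amalgamation would put
  -- `f u` and `f v` into a common chart.
  refine hD ⟨{w | f u ∉ ℒ.toStr.cl (f w)}, {w | f v ∉ ℒ.toStr.cl (f w)}, ?_, ?_, hclosed _,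
    hclosed _, ?_, ?_⟩
  · exact fun h => (h ▸ Set.mem_univ u : u ∈ {w | f u ∉ ℒ.toStr.cl (f w)}) (mem_cl_self _ _)
  · exact fun h => (h ▸ Set.mem_univ v : v ∈ {w | f v ∉ ℒ.toStr.cl (f w)}) (mem_cl_self _ _)
  · refine Set.eq_univ_of_forall fun w => ?_
    by_contra hw
    obtain ⟨ε, x, -, hx, -⟩ := hcov (f w)
    have h1 : f u ∈ ℒ.toStr.cl (f w) := by
      by_contra h1
      exact hw (Or.inl h1)
    have h2 : f v ∈ ℒ.toStr.cl (f w) := by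
      by_contra h2
      exact hw (Or.inr h2)
    rw [← hx] at h1 h2
    exact hno ε x x h1 h2
  · rintro n R x hx ⟨⟨i, -, hi⟩, ⟨k, -, hk⟩⟩
    obtain ⟨ε, y, hy, -⟩ := (hf.map_rel R x).1 hx
    have h1 : ℒ.map ε (y i) = f (x i) := congrFun hy i
    have h2 : ℒ.map ε (y k) = f (x k) := congrFun hy k
    have h3 : f u ∈ ℒ.toStr.cl (f (x k)) := by
      by_contra h3
      exact hk h3
    have h4 : f v ∈ ℒ.toStr.cl (f (x i)) := by
      by_contra h4
      exact hi h4
    refine hno ε (y k) (y i) ?_ ?_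
    · rw [h2]; exact h3
    · rw [h1]; exact h4

/-- Homomorphism-embeddings into the union of the charts whose range can be mapped to `M` give
homomorphism-embeddings into `M`. -/
theorem Real.exists_isHomEmbedding (h : ℒ.Compat) (hcov : ∀ b, ℒ.Adj b b)
    (hgood : ∀ K, ℒ.IsClique K → ℒ.Good K) {X : Type u₇} {M : Str L X} {j : A.Emb M}
    (hj : j.perm = 1) {Y : Type u₆} {D : Str L Y} {g : L.Γ} {f : Y → ℒ.B}
    (hf : D.IsHomEmbedding ℒ.toStr g f) (hreal : ℒ.Real j (Set.range f)) :
    ∃ f' : Y → X, D.IsHomEmbedding M g f' := by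
  obtain ⟨m, hm⟩ := hreal
  have hjM := j.isEmbedding
  rw [hj] at hjM
  have hchart : ∀ ε, ∃ k : V → X, A.IsEmbedding M (ℒ.perm ε) k ∧
      ∀ y x, f y = ℒ.map ε x → m ⟨f y, y, rfl⟩ = k x := by
    intro ε
    obtain ⟨θ, hp, hθ⟩ := hm ε
    refine ⟨θ.toEquiv ∘ j.toFun, ?_, fun y x hyx => ?_⟩
    · have := θ.isEmbedding.comp hjM
      rwa [mul_one, hp] at this
    · refine Eq.trans ?_ (hθ x ⟨y, hyx⟩)
      congr 1
      exact Subtype.ext hyx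
  refine ⟨fun y => m ⟨f y, y, rfl⟩, ⟨fun R x hx => ?_, fun F x => ?_⟩, fun S hS hirr => ?_⟩
  · obtain ⟨ε, z, hz, hz'⟩ := hf.isHom.map_rel R x hx
    obtain ⟨k, hk, hmk⟩ := hchart ε
    have h1 := (hk.map_rel _ _).1 hz'
    rw [onRel_onRel_inv] at h1
    have h2 : (fun y => m ⟨f y, y, rfl⟩) ∘ x = k ∘ z :=
      funext fun i => hmk _ _ (congrFun hz i).symm
    rwa [h2]
  · rintro _ ⟨y, hy, rfl⟩
    obtain ⟨ε, a, b, ha, hb, hab⟩ := hf.isHom.map_fn F x ⟨y, hy, rfl⟩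
    obtain ⟨k, hk, hmk⟩ := hchart ε
    have h1 : k b ∈ k '' A.fn _ a := ⟨b, hab, rfl⟩
    rw [hk.map_fn, onFn_onFn_inv] at h1
    beta_reduce
    rwa [hmk _ _ ha.symm, hmk _ _ hb.symm]
  · have hS' := hf.isEmbedding_restrict S hS hirr
    -- An irreducible substructure has a clique as its image, hence lies in one chart, where the map
    -- to `M` is an embedding.
    obtain ⟨ε, hε⟩ := hgood _ (h.isClique_range hcov hirr hS')
    choose a ha using fun y : S => hε ⟨y, rfl⟩
    obtain ⟨k, hk, hmk⟩ := hchart ε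
    have h1 := hk.comp ((h.isEmbedding_map ε).factor hS' fun y => (ha y).symm)
    rw [mul_inv_cancel_left] at h1
    have h2 : (fun y : S => m ⟨f y, y, rfl⟩) = k ∘ a := funext fun y => hmk _ _ (ha y).symm
    exact h2 ▸ h1

end Level

end EPPA

/-! ### Assembly of the witness -/

theorem theorem1p5 (L : EPPA.PermLanguage)
    {ι : Type*} [Finite ι] {U : ι → Type*} [∀ i, Finite (U i)] (F : ∀ i, EPPA.Str L (U i))
    {V : Type*} [Finite V] (A : EPPA.Str L V) (hA : A.ForbHE F)
    (horbit : (MulAction.orbit L.Γ A).Finite)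
    {X : Type*} (M : EPPA.Str L X) (hM : M.ForbHE F)
    (j : A.Emb M) (hj : j.perm = 1)
    (hext : ∀ f : A.PartialAut, ∃ e : M.Aut, e.Extends j f) :
    ∃ (W : Type) (_ : Finite W) (B : EPPA.Str L W) (ψ : A.Emb B),
      B.ForbHE F ∧ EPPA.Str.IsCoherentEPPAWitness ψ ∧
        EPPA.Str.IsIrreducibleStructureFaithful ψ := by
  obtain ⟨n, hn⟩ : ∃ n, ∀ i, Nat.card (U i) ≤ n := by
    obtain ⟨n, hn⟩ := (Set.finite_range fun i => Nat.card (U i)).bddAbove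
    exact ⟨n, fun i => hn ⟨i, rfl⟩⟩
  obtain ⟨ℒ₀, h₀⟩ := EPPA.exists_compat_level A horbit
  obtain ⟨ℒ₁, h₁, hgood₁, hreal₁⟩ := ℒ₀.exists_real_level h₀ hj hext n
  have := ℒ₁.finite
  obtain ⟨e⟩ : Nonempty ({b // ℒ₁.Adj b b} ≃ Fin (Nat.card {b // ℒ₁.Adj b b})) :=
    ⟨Finite.equivFin _⟩
  -- Vertices outside all charts carry no structure and each forms an irreducible substructure,
  -- which would obstruct faithfulness; they are discarded. The bijection `e` also places the vertex
  -- set in `Type`.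
  set ℒ := ℒ₁.restrict e
  have hc : ℒ.Compat := EPPA.Level.compat_restrict e h₁
  have hcov : ∀ b, ℒ.Adj b b := EPPA.Level.restrict_adj_self e
  have hgood : ∀ K, ℒ.IsClique K → ℒ.Good K := EPPA.Level.good_restrict e hgood₁
  have hreal : ∀ C : Set ℒ.B, C.ncard ≤ n → ℒ.Real j C := fun C hC => by
    refine EPPA.Level.real_restrict e (hreal₁ _ ?_ ?_)
    · rintro _ ⟨b, -, rfl⟩
      exact (e.symm b).2
    · have := ℒ.finite
      exact (Set.ncard_image_le (Set.toFinite C)).trans hC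
  have hψ := hc.isEmbedding_map ℒ.pt
  refine ⟨_, ℒ.finite, ℒ.toStr, ⟨ℒ.perm ℒ.pt, ℒ.map ℒ.pt, hψ⟩, ⟨?_, ?_⟩,
    ⟨fun f => ℒ.aut ℒ.pt ℒ.pt f, fun f => ⟨rfl, fun x => ℒ.Φ_map _ _ f x⟩, fun f g h hfgh => ?_⟩, ?_⟩
  · have := ℒ.finite
    exact Finite.to_countable
  · rintro ⟨i, g, f, hf⟩
    have hcard : (Set.range f).ncard ≤ n := by
      rw [← Set.image_univ]
      refine (Set.ncard_image_le Set.finite_univ).trans ?_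
      rw [Set.ncard_univ]
      exact hn i
    obtain ⟨f', hf'⟩ := (hreal _ hcard).exists_isHomEmbedding hc hcov hgood hj hf
    exact hM.2 ⟨i, g, f', hf'⟩
  · have hΦ := ℒ.Φ_coherent ℒ.pt ℒ.pt ℒ.pt f g h hfgh
    refine ⟨?_, fun x => ?_⟩
    · change ℒ.perm ℒ.pt * h.perm * (ℒ.perm ℒ.pt)⁻¹ = ℒ.perm ℒ.pt * g.perm * (ℒ.perm ℒ.pt)⁻¹ *
        (ℒ.perm ℒ.pt * f.perm * (ℒ.perm ℒ.pt)⁻¹)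
      rw [hfgh.perm_eq]
      group
    · exact congrArg (fun e : Equiv.Perm ℒ.B => e x) hΦ
  · intro C hC hirr
    have hcl := hc.isClique_range hcov hirr (ℒ.toStr.isEmbedding_induce hC)
    rw [Subtype.range_coe] at hcl
    obtain ⟨ε, hε⟩ := hgood C hcl
    have huniv : A.IsClosed Set.univ := fun _ _ _ => Set.subset_univ _
    -- The identity of `A`, read from the chart `ε` containing `C` to the base chart, moves `C` into
    -- the copy of `A`.
    refine ⟨ℒ.aut ε ℒ.pt (EPPA.Str.PartialAut.refl A huniv), ?_⟩
    rintro _ ⟨b, hb, rfl⟩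
    obtain ⟨x, rfl⟩ := hε hb
    exact ⟨x, (ℒ.Φ_map ε ℒ.pt (EPPA.Str.PartialAut.refl A huniv) ⟨x, trivial⟩).symm⟩
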